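/- **Setting.** Let $\mathbb{C}$ denote an algebraically closed field of characteristic zero. A *deformation base* $B$ is a complete local Noetherian commutative unital $\mathbb{C}$-algebra with maximal ideal $\mathfrak m$ and residue field $B/\mathfrak m=\mathbb{C}$. For a vector space $X$ put $B\widehat\otimes X=\varprojlim_n (B/\mathfrak m^n\otimes X)$ with its $\mathfrak m$-adic topology, and let $\mathfrak m^nX\subseteq B\widehat\otimes X$ be the kernel of the projection to $B/\mathfrak m^n\otimes X$. For a subspace $V\subseteq X$ regard $B\widehat\otimes V$ as a submodule of $B\widehat\otimes X$. Let $\mathcal C$ be a strictly unital, $\mathbb Z$- or $\mathbb Z/2\mathbb Z$-graded $A_\infty$-category over $\mathbb C$, with products $\mu^k$ ($k\ge1$) of degree $2-k$ satisfying $\sum(-1)^{\|a_n\|+\dots+\|a_1\|}\mu(a_k,\dots,\mu(a_m,\dots,a_{n+1}),a_n,\dots,a_1)=0$, where $\|a\|=|a|-1$, and identities $\mathrm{id}_X$ of degree $0$ with $\mu^2(a,\mathrm{id}_X)=a$, $\mu^2(\mathrm{id}_Y,a)=(-1)^{|a|}a$, $\mu^{\ge3}(\dots,\mathrm{id}_X,\dots)=0$.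 A (curved) *deformation* $\mathcal C_q$ of $\mathcal C$ over $B$ has the same objects, hom spaces $B\widehat\otimes\mathrm{Hom}_{\mathcal C}(X,Y)$ (with degree $d$ part $B\widehat\otimes\mathrm{Hom}^d_{\mathcal C}(X,Y)$), $B$-multilinear products $\mu_q^k$, $k\ge 0$, of degree $2-k$ with curvature $\mu^0_{q,X}\in\mathfrak m\,\mathrm{End}_{\mathcal C}(X)$, which reduce to $\mu$ modulo $\mathfrak m$ and satisfy the same relations with $\mu_q^0$ included (the curved $A_\infty$-relations). A *functor* $F$ between deformations $\mathcal C_q\to\mathcal C_q'$ of $\mathcal C$ which is the identity on objects consists of $B$-multilinear maps $F^k$, $k\ge0$, of degree $1-k$ with $F^0_X\in\mathfrak m\,\mathrm{End}^1_{\mathcal C}(X)$ such that $$\sum(-1)^{\|a_n\|+\dots+\|a_1\|}F(a_k,\dots,\mu_q(a_m,\dots,a_{n+1}),a_n,\dots,a_1)=\sum\mu_q'(F(a_k,\dots),\dots,F(\dots,a_1)),$$ the right side being the $\mathfrak m$-adically convergent sum over all ways of cutting $a_1,\dots,a_k$ into finitely many, possibly empty, consecutive blocks. It is a *gauge equivalence*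 if modulo $\mathfrak m$ it is the identity functor of $\mathcal C$. For a family $r=(r_X)_X$ with $r_X\in\mathfrak m\,\mathrm{End}^1_{\mathcal C}(X)$, the *uncurving* of $\mathcal C_q$ by $r$ is the deformation of $\mathcal C$ with products $$\mu'(a_k,\dots,a_1)=\sum_{n_0,\dots,n_k\ge0}\mu_q(\underbrace{r,\dots,r}_{n_k},a_k,\dots,a_1,\underbrace{r,\dots,r}_{n_0}),\qquad k\ge0 .$$ A *homological splitting* of $\mathcal C$ is a direct sum decomposition $\mathrm{Hom}_{\mathcal C}(X,Y)=H\oplus I\oplus R$ into graded subspaces, for all $X,Y$, with $I=\mathrm{Im}\,\mu^1$ and $\mathrm{Ker}\,\mu^1=H\oplus I$. Given a deformation $\mathcal C_q$, one has $B\widehat\otimes\mathrm{Hom}_{\mathcal C}=(B\widehat\otimes H)\oplus\mu_q^1(B\widehat\otimes R)\oplus(B\widehat\otimes R)$ with $\mu_q^1$ injective on $B\widehat\otimes R$. For $h\in B\widehat\otimes H$ let $Eh\in B\widehat\otimes R$ be the element such that $\mu_q^1(Eh)$ is the $\mu_q^1(B\widehat\otimes R)$-component of $\mu_q^1(h)$,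 and put $H_q=\{h-Eh\mid h\in B\widehat\otimes H\}$. The *deformed decomposition* of $\mathcal C_q$ is $B\widehat\otimes\mathrm{Hom}_{\mathcal C}=H_q\oplus\mu_q^1(B\widehat\otimes R)\oplus(B\widehat\otimes R)$, and $\mathcal C_q$ has *optimal curvature* if $\mu^0_{q,X}\in H_q(X,X)$ for all $X$. The *curvature optimization procedure* starts with $\mathcal C_q^{(0)}=\mathcal C_q$. In step $i$ one writes the curvature of $\mathcal C_q^{(i)}$, in terms of the deformed decomposition of $\mathcal C_q^{(i)}$, as $h^{(i)}+\mu^1_{\mathcal C_q^{(i)}}(r^{(i)})+r^{(i)\prime}$ with $h^{(i)}\in H_q^{(i)}$ and $r^{(i)},r^{(i)\prime}\in B\widehat\otimes R$, and lets $\mathcal C_q^{(i+1)}$ be the uncurving of $\mathcal C_q^{(i)}$ by $-r^{(i)}$. **Lemma 6.21 (curvature optimization).** Let $\mathcal C$ be an $A_\infty$-category, $\mathcal C_q$ a deformation of $\mathcal C$ over a deformation base $B$, and $H\oplus I\oplus R$ a homological splitting of $\mathcal C$. The curvature optimization procedure can be carried out and determines the deformations $\mathcal C_q^{(i)}$ and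 the elements $r^{(i)}=(r^{(i)}_X)_X$ uniquely. It holds that $r^{(i)}_X\in\mathfrak m^{2^i}\mathrm{End}_{\mathcal C}(X)$ for all $i\in\mathbb N$ and all $X$. Hence $r=\sum_{i\in\mathbb N}r^{(i)}\in\mathfrak m\,\mathrm{End}_{\mathcal C}$ converges. The uncurving $\mathcal C_q^{\mathrm{opt}}$ of $\mathcal C_q$ by $-r$ is a deformation of $\mathcal C$ with optimal curvature, and there is a gauge equivalence $$F:\mathcal C_q^{\mathrm{opt}}\to\mathcal C_q,\qquad F^0=-r,\quad F^1=\mathrm{Id},\quad F^{\ge2}=0 .$$ -/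

import Mathlib

open scoped TensorProduct

universe u u' v w k

namespace CurvedAInf

/-! ### Composable sequences of morphisms -/

/-- `Chain V X Y` is the type of composable sequences `a₁, …, aₖ` (`k ≥ 0`), where
`aᵢ : V Xᵢ Xᵢ₊₁`, `X₁ = X` and `Xₖ₊₁ = Y`. They are written in natural order, so that
`cons a₁ (cons a₂ … )` is the input of the product written `μ(aₖ, …, a₁)`. -/
inductive Chain {Ob : Type u} (V : Ob → Ob → Type v) : Ob → Ob → Type (max u v)
  | nil (X : Ob) : Chain V X X
  | cons {X Y Z : Ob} (a : V X Y) (p : Chain V Y Z) : Chain V X Z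

namespace Chain

variable {Ob : Type u} {V : Ob → Ob → Type v}

/-- The number of morphisms in a sequence. -/
def length : {X Y : Ob} → Chain V X Y → ℕ
  | _, _, nil _ => 0
  | _, _, cons _ p => p.length + 1

/-- The sequence consisting of one morphism. -/
def single {X Y : Ob} (a : V X Y) : Chain V X Y := cons a (nil Y)

/-- Concatenation; the entries of the first argument come first in natural order. -/
def append : {X Y Z : Ob} → Chain V X Y → Chain V Y Z → Chain V X Z
  | _, _, _, nil _, q => q
  | _, _, _, cons a p, q => cons a (append p q)

/-- Apply a map to each entry of a sequence, along a map on objects. -/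
def map {Ob' : Type u'} {W : Ob' → Ob' → Type w} (f : Ob → Ob')
    (φ : ∀ X Y : Ob, V X Y → W (f X) (f Y)) :
    {X Y : Ob} → Chain V X Y → Chain W (f X) (f Y)
  | _, _, nil X => nil (f X)
  | _, _, cons a p => cons (φ _ _ a) (map f φ p)

/-- All ways to write a sequence of length `k` as a concatenation of two sequences
(there are `k + 1` of them). -/
def splits : {X Y : Ob} → Chain V X Y → List ((M : Ob) × (Chain V X M × Chain V M Y))
  | _, _, nil X => [⟨X, nil X, nil X⟩]
  | X, _, cons a p =>
      ⟨X, nil X, cons a p⟩ :: p.splits.map fun s => ⟨s.1, cons a s.2.1, s.2.2⟩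

/-- All ways to cut a sequence into `l` consecutive blocks, empty blocks being allowed. A cutting
is a composable sequence of `l` composable sequences. -/
def partitions : ℕ → {X Y : Ob} → Chain V X Y → List (Chain (Chain V) X Y)
  | 0, _, _, nil X => [nil X]
  | 0, _, _, cons _ _ => []
  | l + 1, _, _, p => p.splits.flatMap fun s => (partitions l s.2.2).map (cons s.2.1)

/-- The sequence `r, …, r` consisting of `n` copies of an endomorphism `r`. -/
def replicate {X : Ob} (r : V X X) : ℕ → Chain V X X
  | 0 => nil X
  | n + 1 => cons r (replicate r n)

/-- The sequence `r, …, r, a₁, r, …, r, a₂, …, aₖ, r, …, r` with `n 0` copies of `r` in front of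
`a₁`, `n 1` copies between `a₁` and `a₂`, …, and `n k` copies behind `aₖ`. -/
def embrace (r : ∀ X : Ob, V X X) :
    {X Y : Ob} → (p : Chain V X Y) → (Fin (p.length + 1) → ℕ) → Chain V X Y
  | _, _, nil X, n => replicate (r X) (n 0)
  | X, _, cons a p, n =>
      (replicate (r X) (n 0)).append (cons a (embrace r p fun i => n i.succ))

/-- `HasDegrees gr p [d₁, …, dₖ]`: the entries `a₁, …, aₖ` of `p` are homogeneous of degrees
`d₁, …, dₖ`. -/
inductive HasDegrees {N : ℕ} {R : Type w} [Semiring R] [∀ X Y, AddCommMonoid (V X Y)]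
    [∀ X Y, Module R (V X Y)] (gr : ∀ X Y : Ob, ZMod N → Submodule R (V X Y)) :
    {X Y : Ob} → Chain V X Y → List (ZMod N) → Prop
  | nil (X : Ob) : HasDegrees gr (Chain.nil X) []
  | cons {X Y Z : Ob} {a : V X Y} {p : Chain V Y Z} {d : ZMod N} {ds : List (ZMod N)} :
      a ∈ gr X Y d → HasDegrees gr p ds → HasDegrees gr (Chain.cons a p) (d :: ds)

end Chain

/-! ### Signs and the curved `A_∞`-relations

Degrees live in `ZMod N`, where `N = 0` is a `ℤ`-grading and `N = 2` a `ℤ/2ℤ`-grading. -/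

/-- The sign `(-1) ^ d`. -/
def sgn {N : ℕ} (d : ZMod N) : ℤ := if (ZMod.cast d : ZMod 2) = 0 then 1 else -1

/-- The total reduced degree `‖a₁‖ + … + ‖aₖ‖`, where `‖a‖ = |a| - 1`. -/
def redDeg {N : ℕ} (ds : List (ZMod N)) : ZMod N := (ds.map fun d => d - 1).sum

/-- `∑ (-1) ^ (‖aₙ‖ + … + ‖a₁‖) G(aₖ, …, μ(aₘ, …, aₙ₊₁), aₙ, …, a₁)` over all `0 ≤ n ≤ m ≤ k`, for
the sequence `p = (a₁, …, aₖ)` of degrees `ds`. -/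
def insertSum {Ob : Type u} {V : Ob → Ob → Type v} {N : ℕ} {X Y : Ob} {A : Type w}
    [AddCommGroup A] (G : Chain V X Y → A) (μ : ∀ {X Y : Ob}, Chain V X Y → V X Y)
    (p : Chain V X Y) (ds : List (ZMod N)) : A :=
  (p.splits.map fun s =>
    sgn (redDeg (ds.take s.2.1.length)) •
      (s.2.2.splits.map fun t =>
        G (s.2.1.append (Chain.cons (μ t.2.1) t.2.2))).sum).sum

/-- A family `G` of maps on composable sequences is multilinear: it is linear in each entry. -/
def IsMultilinear (R : Type w) [Semiring R] {Ob : Type u} {Ob' : Type u'}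
    {V : Ob → Ob → Type v} {W : Ob' → Ob' → Type k}
    [∀ X Y, AddCommMonoid (V X Y)] [∀ X Y, Module R (V X Y)]
    [∀ X Y, AddCommMonoid (W X Y)] [∀ X Y, Module R (W X Y)]
    (f : Ob → Ob') (G : ∀ {X Y : Ob}, Chain V X Y → W (f X) (f Y)) : Prop :=
  ∀ (X Y Z T : Ob) (p : Chain V X Y) (q : Chain V Z T),
    IsLinearMap R fun a : V Y Z => G (p.append (Chain.cons a q))

/-- The family `μ = (μᵏ)_{k ≥ 0}` consists of multilinear maps `μᵏ` of degree `2 - k` that satisfy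
the curved `A_∞`-relations. -/
structure IsCurvedAInf (R : Type w) [Ring R] {Ob : Type u} {V : Ob → Ob → Type v}
    [∀ X Y, AddCommGroup (V X Y)] [∀ X Y, Module R (V X Y)] {N : ℕ}
    (gr : ∀ X Y : Ob, ZMod N → Submodule R (V X Y))
    (μ : ∀ {X Y : Ob}, Chain V X Y → V X Y) : Prop where
  multilinear : IsMultilinear R id μ
  degree : ∀ (X Y : Ob) (p : Chain V X Y) (ds : List (ZMod N)), p.HasDegrees gr ds →
    μ p ∈ gr X Y (redDeg ds + 2)
  relation : ∀ (X Y : Ob) (p : Chain V X Y) (ds : List (ZMod N)), p.HasDegrees gr ds →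
    insertSum μ μ p ds = 0

/-- A strictly unital `A_∞`-category over `𝕜` with object set `Ob`, graded by `ZMod N`. The products
`μᵏ`, `k ≥ 1`, are the values of `μ` on sequences of length `k`; there is no `μ⁰`. -/
structure AInfCat (𝕜 : Type k) [Field 𝕜] (N : ℕ) (Ob : Type u) where
  Hom : Ob → Ob → Type v
  [addCommGroup : ∀ X Y, AddCommGroup (Hom X Y)]
  [module : ∀ X Y, Module 𝕜 (Hom X Y)]
  /-- The homogeneous parts of the hom spaces. -/
  gr : ∀ X Y : Ob, ZMod N → Submodule 𝕜 (Hom X Y)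
  isInternal : ∀ X Y : Ob, DirectSum.IsInternal (gr X Y)
  μ : ∀ {X Y : Ob}, Chain Hom X Y → Hom X Y
  mu_zero : ∀ X : Ob, μ (Chain.nil X) = 0
  isCurvedAInf : IsCurvedAInf 𝕜 gr μ
  one : ∀ X : Ob, Hom X X
  one_mem : ∀ X : Ob, one X ∈ gr X X 0
  mu_two_one : ∀ (X Y : Ob) (a : Hom X Y), μ (Chain.cons (one X) (Chain.single a)) = a
  one_mu_two : ∀ (X Y : Ob) (d : ZMod N) (a : Hom X Y), a ∈ gr X Y d →
    μ (Chain.cons a (Chain.single (one Y))) = sgn d • a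
  mu_one : ∀ (X Y Z : Ob) (p : Chain Hom X Y) (q : Chain Hom Y Z), 2 ≤ p.length + q.length →
    μ (p.append (Chain.cons (one Y) q)) = 0

attribute [instance] AInfCat.addCommGroup AInfCat.module

/-! ### The completed tensor product -/

section CompletedTensor

variable (𝕜 : Type k) [Field 𝕜] (B : Type w) [CommRing B] [IsLocalRing B] [Algebra 𝕜 B]
  (X : Type v) [AddCommGroup X] [Module 𝕜 X]

/-- The completed tensor product `B ⊗̂ X`, the limit of the `B`-modules
`(B ⊗ X) / 𝔪ⁿ (B ⊗ X) = B / 𝔪ⁿ ⊗ X`. -/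
abbrev CTensor : Type (max w v) := AdicCompletion (IsLocalRing.maximalIdeal B) (B ⊗[𝕜] X)

variable {X}

/-- The map `X → B ⊗̂ X`, `x ↦ 1 ⊗ x`. -/
noncomputable def incl (x : X) : CTensor 𝕜 B X :=
  AdicCompletion.of (IsLocalRing.maximalIdeal B) (B ⊗[𝕜] X) ((1 : B) ⊗ₜ[𝕜] x)

variable (X) in
/-- The part `𝔪ⁿ X = 𝔪ⁿ ⊗̂ X` of `B ⊗̂ X`, the kernel of `B ⊗̂ X → B / 𝔪ⁿ ⊗ X`. -/
noncomputable def infPart (n : ℕ) : Submodule B (CTensor 𝕜 B X) :=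
  LinearMap.ker (AdicCompletion.eval (IsLocalRing.maximalIdeal B) (B ⊗[𝕜] X) n)

/-- The submodule `B ⊗̂ V` of `B ⊗̂ X`, for a subspace `V` of `X`. -/
noncomputable def cSub (V : Submodule 𝕜 X) : Submodule B (CTensor 𝕜 B X) :=
  LinearMap.range
    ((AdicCompletion.map (IsLocalRing.maximalIdeal B) (V.subtype.baseChange B)).restrictScalars B)

/-- The series `∑ f n` converges to `x` in the `𝔪`-adic topology of `B ⊗̂ X`. -/
def HasAdicSum (f : ℕ → CTensor 𝕜 B X) (x : CTensor 𝕜 B X) : Prop :=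
  ∀ K : ℕ, ∃ n₀ : ℕ, ∀ n ≥ n₀, x - ∑ i ∈ Finset.range n, f i ∈ infPart 𝕜 B X K

end CompletedTensor

/-! ### Deformations, functors, gauge equivalences -/

section Deformations

variable {𝕜 : Type k} [Field 𝕜] {N : ℕ} {Ob : Type u} {Ob' : Type u'}

/-- The deformed hom space `B ⊗̂ Hom(X, Y)`. -/
abbrev AInfCat.HomQ (C : AInfCat.{u, v} 𝕜 N Ob) (B : Type w) [CommRing B] [IsLocalRing B]
    [Algebra 𝕜 B] (X Y : Ob) : Type (max w v) := CTensor 𝕜 B (C.Hom X Y)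

/-- The part `B ⊗̂ Homᵈ(X, Y)` of degree `d` of the deformed hom space. -/
noncomputable def AInfCat.grQ (C : AInfCat.{u, v} 𝕜 N Ob) (B : Type w) [CommRing B] [IsLocalRing B]
    [Algebra 𝕜 B] (X Y : Ob) (d : ZMod N) : Submodule B (C.HomQ B X Y) :=
  cSub 𝕜 B (C.gr X Y d)

/-- The sequence `1 ⊗ a₁, …, 1 ⊗ aₖ` of deformed morphisms, for a sequence `a₁, …, aₖ` in `C`. -/
noncomputable def AInfCat.inclChain (C : AInfCat.{u, v} 𝕜 N Ob) (B : Type w) [CommRing B]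
    [IsLocalRing B] [Algebra 𝕜 B] {X Y : Ob} (p : Chain C.Hom X Y) : Chain (C.HomQ B) X Y :=
  p.map id fun _ _ => incl 𝕜 B

/-- An (infinitesimally curved) deformation of the `A_∞`-category `C` over `B`. -/
@[ext]
structure Deformation (C : AInfCat.{u, v} 𝕜 N Ob) (B : Type w) [CommRing B] [IsLocalRing B]
    [Algebra 𝕜 B] where
  /-- The products `μ_qᵏ`, `k ≥ 0`; the curvature of `X` is the value at `Chain.nil X`. -/
  μ : ∀ {X Y : Ob}, Chain (C.HomQ B) X Y → C.HomQ B X Y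
  isCurvedAInf : IsCurvedAInf B (C.grQ B) μ
  curvature_mem : ∀ X : Ob, μ (Chain.nil X) ∈ infPart 𝕜 B (C.Hom X X) 1
  reduces : ∀ (X Y : Ob) (p : Chain C.Hom X Y),
    μ (C.inclChain B p) - incl 𝕜 B (C.μ p) ∈ infPart 𝕜 B (C.Hom X Y) 1

variable {B : Type w} [CommRing B] [IsLocalRing B] [Algebra 𝕜 B]

/-- The curvature `μ_q⁰` at the object `X`. -/
def Deformation.curv {C : AInfCat.{u, v} 𝕜 N Ob} (D : Deformation C B) (X : Ob) : C.HomQ B X X :=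
  D.μ (Chain.nil X)

/-- The deformed differential `μ_q¹`. -/
def Deformation.diff {C : AInfCat.{u, v} 𝕜 N Ob} (D : Deformation C B) {X Y : Ob}
    (a : C.HomQ B X Y) : C.HomQ B X Y :=
  D.μ (Chain.single a)

/-- A functor of deformed `A_∞`-categories with object map `f`. Its component `Fᵏ`, `k ≥ 0`, is the
value of `comp` on sequences of length `k`. In the relation, the left hand side
`∑ ± F(…, μ(…), …)` is required to be the sum of the convergent series
`∑ₗ ∑ μ(F(…), …, F(…))` (`l` blocks, possibly empty). -/
structure DefFunctor {C : AInfCat.{u, v} 𝕜 N Ob} {C' : AInfCat.{u', v} 𝕜 N Ob'}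
    (D : Deformation C B) (D' : Deformation C' B) (f : Ob → Ob') where
  comp : ∀ {X Y : Ob}, Chain (C.HomQ B) X Y → C'.HomQ B (f X) (f Y)
  multilinear : IsMultilinear B f comp
  degree : ∀ (X Y : Ob) (p : Chain (C.HomQ B) X Y) (ds : List (ZMod N)),
    p.HasDegrees (C.grQ B) ds → comp p ∈ C'.grQ B (f X) (f Y) (redDeg ds + 1)
  comp_nil_mem : ∀ X : Ob, comp (Chain.nil X) ∈ infPart 𝕜 B (C'.Hom (f X) (f X)) 1
  relation : ∀ (X Y : Ob) (p : Chain (C.HomQ B) X Y) (ds : List (ZMod N)),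
    p.HasDegrees (C.grQ B) ds →
      HasAdicSum 𝕜 B
        (fun l => ((p.partitions l).map fun Q => D'.μ (Q.map f fun _ _ q => comp q)).sum)
        (insertSum comp D.μ p ds)

variable {C : AInfCat.{u, v} 𝕜 N Ob}

/-- The components of a functor, between deformations of `C`, that is the identity on objects. -/
def DefFunctor.compId {D D' : Deformation C B} (F : DefFunctor D D' id) {X Y : Ob}
    (p : Chain (C.HomQ B) X Y) : C.HomQ B X Y :=
  F.comp p

/-- A functor between two deformations of `C`, the identity on objects, is a gauge equivalence if
its leading term is the identity functor of `C`. -/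
structure DefFunctor.IsGaugeEquivalence {D D' : Deformation C B} (F : DefFunctor D D' id) :
    Prop where
  one : ∀ (X Y : Ob) (a : C.Hom X Y),
    F.compId (Chain.single (incl 𝕜 B a)) - incl 𝕜 B a ∈ infPart 𝕜 B (C.Hom X Y) 1
  higher : ∀ (X Y : Ob) (p : Chain C.Hom X Y), 2 ≤ p.length →
    F.compId (C.inclChain B p) ∈ infPart 𝕜 B (C.Hom X Y) 1

/-- `D'` is the uncurving of `D` by the family `r` of elements `r X` of `𝔪 End¹(X)`:
`μ'(aₖ, …, a₁) = ∑ μ(r, …, r, aₖ, r, …, r, …, a₁, r, …, r)`, the sum running over all numbers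
`n₀, …, nₖ ≥ 0` of insertions. The series is ordered by the total number of insertions. -/
structure IsUncurving (D : Deformation C B) (r : ∀ X : Ob, C.HomQ B X X) (D' : Deformation C B) :
    Prop where
  mem_infPart : ∀ X : Ob, r X ∈ infPart 𝕜 B (C.Hom X X) 1
  mem_gr : ∀ X : Ob, r X ∈ C.grQ B X X 1
  hasSum : ∀ (X Y : Ob) (p : Chain (C.HomQ B) X Y),
    HasAdicSum 𝕜 B
      (fun j => ∑ n ∈ Finset.Nat.antidiagonalTuple (p.length + 1) j, D.μ (p.embrace r n))
      (D'.μ p)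

/-! ### Homological splittings, the deformed decomposition, optimal curvature -/

/-- A homological splitting `Hom = H ⊕ I ⊕ R` by graded subspaces (`I` is automatically graded,
being the image of the differential). -/
structure HomologicalSplitting (C : AInfCat.{u, v} 𝕜 N Ob) where
  H : ∀ X Y : Ob, Submodule 𝕜 (C.Hom X Y)
  I : ∀ X Y : Ob, Submodule 𝕜 (C.Hom X Y)
  R : ∀ X Y : Ob, Submodule 𝕜 (C.Hom X Y)
  isInternal : ∀ X Y : Ob, DirectSum.IsInternal ![H X Y, I X Y, R X Y]
  mem_I_iff : ∀ (X Y : Ob) (a : C.Hom X Y), a ∈ I X Y ↔ ∃ b : C.Hom X Y, C.μ (Chain.single b) = a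
  mu_eq_zero_iff : ∀ (X Y : Ob) (a : C.Hom X Y), C.μ (Chain.single a) = 0 ↔ a ∈ H X Y ⊔ I X Y
  graded_H : ∀ X Y : Ob, H X Y = ⨆ d : ZMod N, H X Y ⊓ C.gr X Y d
  graded_R : ∀ X Y : Ob, R X Y = ⨆ d : ZMod N, R X Y ⊓ C.gr X Y d

/-- The deformed counterpart `H_q = {h - E h | h ∈ B ⊗̂ H}` of `H`. Here `E h` is the element `e` of
`B ⊗̂ R` such that `μ_q¹(e)` is the component of `μ_q¹(h)` in the middle summand of the
decomposition `(B ⊗̂ H) ⊕ μ_q¹(B ⊗̂ R) ⊕ (B ⊗̂ R)`. -/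
def HomologicalSplitting.Hq (S : HomologicalSplitting C) (D : Deformation C B) (X Y : Ob) :
    Set (C.HomQ B X Y) :=
  {x | ∃ h ∈ cSub 𝕜 B (S.H X Y), ∃ e ∈ cSub 𝕜 B (S.R X Y),
    D.diff h - D.diff e ∈ cSub 𝕜 B (S.H X Y) ⊔ cSub 𝕜 B (S.R X Y) ∧ x = h - e}

/-- The curvature of `D` is optimal: it lies in `H_q`. -/
def HasOptimalCurvature (S : HomologicalSplitting C) (D : Deformation C B) : Prop :=
  ∀ X : Ob, D.curv X ∈ S.Hq D X X

/-- The deformations `Cs i` and elements `rs i` arise from running the curvature optimization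
procedure on `D`: start with `D`; write the curvature of `Cs i` as `h + μ¹(rs i) + r'` in terms of the
deformed decomposition `H_q ⊕ μ_q¹(B ⊗̂ R) ⊕ (B ⊗̂ R)` of `Cs i`; let `Cs (i + 1)` be the
uncurving of `Cs i` by `- rs i`. -/
structure IsCurvatureOptimization (S : HomologicalSplitting C) (D : Deformation C B)
    (Cs : ℕ → Deformation C B) (rs : ℕ → ∀ X : Ob, C.HomQ B X X) : Prop where
  start : Cs 0 = D
  mem_R : ∀ (i : ℕ) (X : Ob), rs i X ∈ cSub 𝕜 B (S.R X X)
  curv_eq : ∀ (i : ℕ) (X : Ob), ∃ h ∈ S.Hq (Cs i) X X, ∃ r' ∈ cSub 𝕜 B (S.R X X),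
    (Cs i).curv X = h + (Cs i).diff (rs i X) + r'
  step : ∀ i : ℕ, IsUncurving (Cs i) (-rs i) (Cs (i + 1))

end Deformations

end CurvedAInf

/-! Uncurving by `-r` changes the curvature by `-μ_q¹(r)` plus terms with at least two copies of
`r`. If the curvature is `h + μ_q¹(r) + r'` with `r` in `𝔪^K`, the new curvature is therefore `h +
r'` modulo `𝔪^(2K)`. The sum of `B ⊗̂ H` and `B ⊗̂ R` does not depend on the deformation, and
replacing `H_q` by `B ⊗̂ H` only moves an element of `B ⊗̂ R` (`exists_of_mem_Hq`). So `h + r'` has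
no middle component for the new deformation either, and the next `r` lies in `𝔪^(2K)`.

The estimate rests on one linear map, `Contraction.deform`, which carries the splitting `H ⊕ I ⊕ R`
to its deformed counterpart. It is the identity modulo `𝔪`, so a Neumann series inverts it, and it
preserves the `𝔪`-adic filtration and the degree.

That uncurvings are deformations is combinatorics of insertions, organised by `shuffleSum`, which
sums over all sequences of a given length obtained by inserting `r`. Cutting a sequence commutes
with inserting (`shuffleSum_splitSum`, `shuffleSum_append_cons`), and `‖r‖ = 0` means that insertion
alters neither signs nor degrees; the relations for `μ'` are thus sums of relations for `μ`
(`IsTwist.relation`). Linearity in each entry makes successive uncurvings add up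
(`IsUncurving.trans`). For the functor with `F⁰ = r`, `F¹ = Id`, cutting into `l` blocks is the same
as inserting up to length `l` (`sum_partitions`), so its functor equation is the defining series of
the uncurving.

For the limit, the uncurving by `-∑ rs i` is also the uncurving of `Cs n` by the negative of the
tail of the series (`isUncurving_tail`). Its curvature agrees with that of `Cs n` modulo `𝔪^n`, so
its middle component lies in every `𝔪^n` and vanishes. The remaining curvature `a + r'` satisfies
`μ_q¹(a + r') = 0`, which says `E a = -r'` and puts it in `H_q`. -/

namespace CurvedAInf

/-! ### The `𝔪`-adic filtration on completed tensor products -/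

section CompletedTensorLemmas

variable {𝕜 : Type k} [Field 𝕜] {B : Type w} [CommRing B] [IsLocalRing B] [Algebra 𝕜 B]
  {X Y Z : Type v} [AddCommGroup X] [Module 𝕜 X] [AddCommGroup Y] [Module 𝕜 Y]
  [AddCommGroup Z] [Module 𝕜 Z]

theorem infPart_antitone {m n : ℕ} (h : m ≤ n) : infPart 𝕜 B X n ≤ infPart 𝕜 B X m := by
  intro x hx
  simp only [infPart, LinearMap.mem_ker] at hx ⊢
  have h1 := AdicCompletion.transitionMap_comp_eval_apply (I := IsLocalRing.maximalIdeal B)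
    (M := B ⊗[𝕜] X) h x
  exact h1.symm.trans ((congrArg _ hx).trans (map_zero _))

theorem mem_infPart_zero (x : CTensor 𝕜 B X) : x ∈ infPart 𝕜 B X 0 := by
  have h : Subsingleton ((B ⊗[𝕜] X) ⧸
      ((IsLocalRing.maximalIdeal B) ^ 0 • ⊤ : Submodule B (B ⊗[𝕜] X))) :=
    Submodule.Quotient.subsingleton_iff.mpr (by simp)
  exact h.elim _ _

theorem eq_zero_of_forall_mem_infPart {x : CTensor 𝕜 B X} (h : ∀ n, x ∈ infPart 𝕜 B X n) :
    x = 0 :=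
  AdicCompletion.ext fun n => h n

theorem eq_of_forall_sub_mem_infPart {x y : CTensor 𝕜 B X}
    (h : ∀ n, x - y ∈ infPart 𝕜 B X n) : x = y :=
  sub_eq_zero.mp (eq_zero_of_forall_mem_infPart h)

/-- This uses that `𝔪` is finitely generated. It makes every `B`-linear map filtered, hence
continuous, without further assumption. -/
theorem infPart_eq_smul_top [IsNoetherianRing B] (n : ℕ) :
    infPart 𝕜 B X n = (IsLocalRing.maximalIdeal B) ^ n • (⊤ : Submodule B (CTensor 𝕜 B X)) :=
  (AdicCompletion.pow_smul_top_eq_ker_eval (IsNoetherian.noetherian _)).symm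

theorem linearMap_mem_infPart [IsNoetherianRing B] (f : CTensor 𝕜 B X →ₗ[B] CTensor 𝕜 B Y)
    {m n : ℕ} (hf : ∀ x, f x ∈ infPart 𝕜 B Y m) {x : CTensor 𝕜 B X} (hx : x ∈ infPart 𝕜 B X n) :
    f x ∈ infPart 𝕜 B Y (m + n) := by
  have h : f x ∈ (infPart 𝕜 B X n).map f := Submodule.mem_map_of_mem hx
  rw [infPart_eq_smul_top, Submodule.map_smul''] at h
  rw [infPart_eq_smul_top, add_comm, pow_add, Submodule.mul_smul, ← infPart_eq_smul_top]
  refine Submodule.smul_mono le_rfl ?_ h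
  rintro _ ⟨y, -, rfl⟩
  exact hf y

theorem linearMap_mem_infPart_of_mem [IsNoetherianRing B]
    (f : CTensor 𝕜 B X →ₗ[B] CTensor 𝕜 B Y)
    {n : ℕ} {x : CTensor 𝕜 B X} (hx : x ∈ infPart 𝕜 B X n) : f x ∈ infPart 𝕜 B Y n := by
  simpa using linearMap_mem_infPart f (m := 0) (fun x => mem_infPart_zero _) hx

/-- A linear map with small values on the constant elements has small values. -/
theorem linearMap_mem_infPart_of_incl [IsNoetherianRing B]
    (f : CTensor 𝕜 B X →ₗ[B] CTensor 𝕜 B Y)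
    {n : ℕ} (hf : ∀ x, f (incl 𝕜 B x) ∈ infPart 𝕜 B Y n) (x : CTensor 𝕜 B X) :
    f x ∈ infPart 𝕜 B Y n := by
  have hof : ∀ z : B ⊗[𝕜] X, f (AdicCompletion.of _ _ z) ∈ infPart 𝕜 B Y n := by
    intro z
    induction z using TensorProduct.induction_on with
    | zero => simp
    | add a b ha hb => rw [map_add, map_add]; exact add_mem ha hb
    | tmul b x =>
      have : b ⊗ₜ[𝕜] x = b • ((1 : B) ⊗ₜ[𝕜] x) := by simp [TensorProduct.smul_tmul']
      rw [this, map_smul, map_smul]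
      exact Submodule.smul_mem _ _ (hf x)
  -- Modulo `infPart n` every element comes from the uncompleted tensor product.
  obtain ⟨z, hz⟩ := Submodule.mkQ_surjective _ (AdicCompletion.eval
    (IsLocalRing.maximalIdeal B) (B ⊗[𝕜] X) n x)
  have hx : x - AdicCompletion.of _ _ z ∈ infPart 𝕜 B X n := by
    simp only [infPart, LinearMap.mem_ker, map_sub, AdicCompletion.eval_of, hz, sub_self]
  have := add_mem (linearMap_mem_infPart_of_mem f hx) (hof z)
  rwa [map_sub, sub_add_cancel] at this

/-! #### Convergent series -/

theorem HasAdicSum.unique {f : ℕ → CTensor 𝕜 B X} {x y : CTensor 𝕜 B X}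
    (hx : HasAdicSum 𝕜 B f x) (hy : HasAdicSum 𝕜 B f y) : x = y := by
  refine eq_of_forall_sub_mem_infPart fun K => ?_
  obtain ⟨n, hn⟩ := hx K
  obtain ⟨m, hm⟩ := hy K
  have := sub_mem (hn (max n m) (le_max_left _ _)) (hm (max n m) (le_max_right _ _))
  rwa [sub_sub_sub_cancel_right] at this

theorem HasAdicSum.add {f g : ℕ → CTensor 𝕜 B X} {x y : CTensor 𝕜 B X}
    (hx : HasAdicSum 𝕜 B f x) (hy : HasAdicSum 𝕜 B g y) :
    HasAdicSum 𝕜 B (fun n => f n + g n) (x + y) := by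
  intro K
  obtain ⟨n, hn⟩ := hx K
  obtain ⟨m, hm⟩ := hy K
  refine ⟨max n m, fun l hl => ?_⟩
  rw [Finset.sum_add_distrib, add_sub_add_comm]
  exact add_mem (hn l (le_trans (le_max_left _ _) hl)) (hm l (le_trans (le_max_right _ _) hl))

theorem hasAdicSum_zero : HasAdicSum 𝕜 B (fun _ => (0 : CTensor 𝕜 B X)) 0 :=
  fun _ => ⟨0, fun _ _ => by simp⟩

theorem HasAdicSum.map [IsNoetherianRing B] {f : ℕ → CTensor 𝕜 B X} {x : CTensor 𝕜 B X}
    (φ : CTensor 𝕜 B X →ₗ[B] CTensor 𝕜 B Y) (hx : HasAdicSum 𝕜 B f x) :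
    HasAdicSum 𝕜 B (fun n => φ (f n)) (φ x) := by
  intro K
  obtain ⟨n, hn⟩ := hx K
  refine ⟨n, fun l hl => ?_⟩
  rw [← map_sum, ← map_sub]
  exact linearMap_mem_infPart_of_mem φ (hn l hl)

theorem HasAdicSum.smul [IsNoetherianRing B] {f : ℕ → CTensor 𝕜 B X} {x : CTensor 𝕜 B X} (b : B)
    (hx : HasAdicSum 𝕜 B f x) : HasAdicSum 𝕜 B (fun n => b • f n) (b • x) :=
  hx.map (LinearMap.lsmul B _ b)

theorem HasAdicSum.zsmul {f : ℕ → CTensor 𝕜 B X} {x : CTensor 𝕜 B X} (b : ℤ)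
    (hx : HasAdicSum 𝕜 B f x) : HasAdicSum 𝕜 B (fun n => b • f n) (b • x) := by
  intro K
  obtain ⟨n, hn⟩ := hx K
  refine ⟨n, fun l hl => ?_⟩
  rw [← Finset.smul_sum, ← smul_sub]
  exact zsmul_mem (hn l hl) b

theorem hasAdicSum_list_sum {ι : Type*} (L : List ι) (f : ι → ℕ → CTensor 𝕜 B X)
    (x : ι → CTensor 𝕜 B X) (h : ∀ i ∈ L, HasAdicSum 𝕜 B (f i) (x i)) :
    HasAdicSum 𝕜 B (fun n => (L.map fun i => f i n).sum) (L.map x).sum := by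
  induction L with
  | nil => simpa using hasAdicSum_zero
  | cons a L ih =>
    simp only [List.map_cons, List.sum_cons]
    exact (h a (by simp)).add (ih fun i hi => h i (by simp [hi]))

theorem HasAdicSum.shift {f : ℕ → CTensor 𝕜 B X} {x : CTensor 𝕜 B X} (c : ℕ)
    (h : HasAdicSum 𝕜 B (fun n => f (n + c)) x) (h0 : ∀ n < c, f n = 0) :
    HasAdicSum 𝕜 B f x := by
  intro K
  obtain ⟨n, hn⟩ := h K
  refine ⟨n + c, fun l hl => ?_⟩
  obtain ⟨m, rfl⟩ := Nat.exists_eq_add_of_le' (le_trans (Nat.le_add_left c n) hl)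
  rw [add_comm m c, Finset.sum_range_add, Finset.sum_eq_zero (fun i hi => h0 i (by simpa using hi)),
    zero_add]
  simpa [add_comm] using hn m (by omega)

theorem HasAdicSum.unshift {f : ℕ → CTensor 𝕜 B X} {x : CTensor 𝕜 B X} (c : ℕ)
    (h : HasAdicSum 𝕜 B f x) (h0 : ∀ n < c, f n = 0) :
    HasAdicSum 𝕜 B (fun n => f (n + c)) x := by
  intro K
  obtain ⟨n, hn⟩ := h K
  refine ⟨n, fun l hl => ?_⟩
  have := hn (c + l) (by omega)
  rw [Finset.sum_range_add, Finset.sum_eq_zero (fun i hi => h0 i (by simpa using hi)),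
    zero_add] at this
  simpa [add_comm] using this

theorem HasAdicSum.sub_sum {f : ℕ → CTensor 𝕜 B X} {x : CTensor 𝕜 B X} (c : ℕ)
    (h : HasAdicSum 𝕜 B f x) :
    HasAdicSum 𝕜 B (fun n => f (n + c)) (x - ∑ i ∈ Finset.range c, f i) := by
  intro K
  obtain ⟨n, hn⟩ := h K
  refine ⟨n, fun l hl => ?_⟩
  have := hn (c + l) (by omega)
  rw [Finset.sum_range_add, ← sub_sub] at this
  simpa [add_comm] using this

/-- A submodule is closed in the adic topology. -/
def IsAdicClosed (S : Submodule B (CTensor 𝕜 B X)) : Prop :=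
  ∀ x, (∀ K, ∃ y ∈ S, x - y ∈ infPart 𝕜 B X K) → x ∈ S

theorem HasAdicSum.mem {S : Submodule B (CTensor 𝕜 B X)} (hS : IsAdicClosed S)
    {f : ℕ → CTensor 𝕜 B X} {x : CTensor 𝕜 B X} (h : HasAdicSum 𝕜 B f x) (hf : ∀ n, f n ∈ S) :
    x ∈ S := by
  refine hS x fun K => ?_
  obtain ⟨n, hn⟩ := h K
  exact ⟨_, Submodule.sum_mem _ fun i _ => hf i, hn n le_rfl⟩

theorem isAdicClosed_infPart (n : ℕ) : IsAdicClosed (infPart 𝕜 B X n) := by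
  intro x h
  obtain ⟨y, hy, hxy⟩ := h n
  simpa using add_mem hxy hy

/-- Modulo `𝔪^K` the partial sums are constant from `K + c` on, and these values form a compatible
system. The offset `c` will be the length of a sequence: its extensions to length `n` contain `n -
c` inserted small elements. -/
theorem exists_hasAdicSum (f : ℕ → CTensor 𝕜 B X) (c : ℕ)
    (hf : ∀ n, f n ∈ infPart 𝕜 B X (n - c)) : ∃ x, HasAdicSum 𝕜 B f x := by
  have key : ∀ K m n, K + c ≤ m → m ≤ n →
      ∑ i ∈ Finset.range n, f i - ∑ i ∈ Finset.range m, f i ∈ infPart 𝕜 B X K := by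
    intro K m n hKm hmn
    obtain ⟨d, rfl⟩ := Nat.exists_eq_add_of_le hmn
    rw [Finset.sum_range_add, add_sub_cancel_left]
    exact Submodule.sum_mem _ fun i _ => infPart_antitone (by omega) (hf _)
  obtain ⟨x, hx⟩ : ∃ x : CTensor 𝕜 B X, ∀ K, AdicCompletion.eval _ _ K x =
      AdicCompletion.eval _ _ K (∑ i ∈ Finset.range (K + c), f i) := by
    refine ⟨⟨fun K => AdicCompletion.eval _ _ K (∑ i ∈ Finset.range (K + c), f i), ?_⟩,
      fun K => rfl⟩
    intro m n hmn
    have h1 := AdicCompletion.transitionMap_comp_eval_apply (I := IsLocalRing.maximalIdeal B)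
      (M := B ⊗[𝕜] X) hmn (∑ i ∈ Finset.range (n + c), f i)
    have h2 := key m (m + c) (n + c) le_rfl (by omega)
    rw [infPart, LinearMap.mem_ker, map_sub, sub_eq_zero] at h2
    exact h1.trans h2
  refine ⟨x, fun K => ⟨K + c, fun n hn => ?_⟩⟩
  have h2 := key K (K + c) n le_rfl hn
  rw [infPart, LinearMap.mem_ker, map_sub, sub_eq_zero] at h2 ⊢
  rw [h2, hx]

/-- Summation of a double series along finite exhausting sets of indices. -/
theorem hasAdicSum_double (f : ℕ → ℕ → CTensor 𝕜 B X) (g : ℕ → CTensor 𝕜 B X)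
    (x : CTensor 𝕜 B X) (hg : ∀ a, HasAdicSum 𝕜 B (f a) (g a)) (hx : HasAdicSum 𝕜 B g x)
    (hf : ∀ K, ∃ n₀, ∀ a l, (n₀ ≤ a ∨ n₀ ≤ l) → f a l ∈ infPart 𝕜 B X K) (K : ℕ) :
    ∃ n₀, ∀ S : Finset (ℕ × ℕ), Finset.range n₀ ×ˢ Finset.range n₀ ⊆ S →
      x - ∑ p ∈ S, f p.1 p.2 ∈ infPart 𝕜 B X K := by
  obtain ⟨n₁, h₁⟩ := hf K
  obtain ⟨n₂, h₂⟩ := hx K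
  set n₀ := max n₁ n₂
  refine ⟨n₀, fun S hS => ?_⟩
  have hrow : ∀ a, g a - ∑ l ∈ Finset.range n₀, f a l ∈ infPart 𝕜 B X K := by
    intro a
    obtain ⟨m, hm⟩ := hg a K
    have h3 := hm (n₀ + m) (by omega)
    rw [Finset.sum_range_add, ← sub_sub] at h3
    have h4 : ∑ i ∈ Finset.range m, f a (n₀ + i) ∈ infPart 𝕜 B X K :=
      Submodule.sum_mem _ fun i _ => h₁ _ _ (Or.inr (by omega))
    simpa using add_mem h3 h4
  have h5 := h₂ n₀ (le_max_right _ _)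
  have h6 : ∑ a ∈ Finset.range n₀, g a - ∑ p ∈ Finset.range n₀ ×ˢ Finset.range n₀, f p.1 p.2
      ∈ infPart 𝕜 B X K := by
    rw [Finset.sum_product, ← Finset.sum_sub_distrib]
    exact Submodule.sum_mem _ fun a _ => hrow a
  have h7 : ∑ p ∈ S \ (Finset.range n₀ ×ˢ Finset.range n₀), f p.1 p.2 ∈ infPart 𝕜 B X K := by
    refine Submodule.sum_mem _ fun p hp => h₁ _ _ ?_
    simp only [Finset.mem_sdiff, Finset.mem_product, Finset.mem_range, not_and_or, not_lt] at hp
    rcases hp.2 with h | h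
    · left; omega
    · right; omega
  rw [← Finset.sum_sdiff hS]
  have := sub_mem (add_mem h5 h6) h7
  convert this using 1
  abel

/-! #### Completed linear maps -/

variable (B) in
/-- The completion `B ⊗̂ X → B ⊗̂ Y` of a linear map `X → Y`. -/
noncomputable def cMap (f : X →ₗ[𝕜] Y) : CTensor 𝕜 B X →ₗ[B] CTensor 𝕜 B Y :=
  (AdicCompletion.map (IsLocalRing.maximalIdeal B) (f.baseChange B)).restrictScalars B

theorem cMap_incl (f : X →ₗ[𝕜] Y) (x : X) : cMap B f (incl 𝕜 B x) = incl 𝕜 B (f x) := by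
  simp [cMap, incl, AdicCompletion.map_of]

theorem cMap_cMap (g : Y →ₗ[𝕜] Z) (f : X →ₗ[𝕜] Y) (x : CTensor 𝕜 B X) :
    cMap B g (cMap B f x) = cMap B (g ∘ₗ f) x := by
  simp [cMap, AdicCompletion.map_comp_apply, LinearMap.baseChange_comp]

theorem cMap_id (x : CTensor 𝕜 B X) : cMap B LinearMap.id x = x := by
  simp [cMap]

theorem mem_cSub_iff {V : Submodule 𝕜 X} {x : CTensor 𝕜 B X} :
    x ∈ cSub 𝕜 B V ↔ ∃ y, cMap B V.subtype y = x :=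
  Iff.rfl

theorem cMap_mem_cSub (f : X →ₗ[𝕜] Y) {V : Submodule 𝕜 X} {W : Submodule 𝕜 Y}
    (h : ∀ x ∈ V, f x ∈ W) {x : CTensor 𝕜 B X} (hx : x ∈ cSub 𝕜 B V) :
    cMap B f x ∈ cSub 𝕜 B W := by
  obtain ⟨y, rfl⟩ := mem_cSub_iff.mp hx
  refine mem_cSub_iff.mpr ⟨cMap B (f.restrict h) y, ?_⟩
  rw [cMap_cMap, cMap_cMap]
  rfl

theorem mem_cSub_top (x : CTensor 𝕜 B X) : x ∈ cSub 𝕜 B (⊤ : Submodule 𝕜 X) := by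
  refine mem_cSub_iff.mpr ⟨cMap B (LinearMap.codRestrict ⊤ LinearMap.id fun _ => trivial) x, ?_⟩
  rw [cMap_cMap]
  exact cMap_id x

theorem cMap_mem_cSub_range (f : X →ₗ[𝕜] Y) {W : Submodule 𝕜 Y}
    (h : ∀ x, f x ∈ W) (x : CTensor 𝕜 B X) : cMap B f x ∈ cSub 𝕜 B W :=
  cMap_mem_cSub f (V := ⊤) (fun x _ => h x) (mem_cSub_top x)

theorem cMap_congr_of_mem_cSub {f g : X →ₗ[𝕜] Y} {V : Submodule 𝕜 X} (h : ∀ x ∈ V, f x = g x)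
    {x : CTensor 𝕜 B X} (hx : x ∈ cSub 𝕜 B V) : cMap B f x = cMap B g x := by
  obtain ⟨y, rfl⟩ := mem_cSub_iff.mp hx
  rw [cMap_cMap, cMap_cMap]
  congr 2
  exact LinearMap.ext fun z => h z z.2

theorem cMap_zero (x : CTensor 𝕜 B X) : cMap B (0 : X →ₗ[𝕜] Y) x = 0 := by
  simp [cMap]

theorem cMap_eq_self_of_mem_cSub {f : X →ₗ[𝕜] X} {V : Submodule 𝕜 X} (h : ∀ x ∈ V, f x = x)
    {x : CTensor 𝕜 B X} (hx : x ∈ cSub 𝕜 B V) : cMap B f x = x :=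
  (cMap_congr_of_mem_cSub (g := LinearMap.id) h hx).trans (cMap_id x)

theorem cMap_eq_zero_of_mem_cSub {f : X →ₗ[𝕜] Y} {V : Submodule 𝕜 X} (h : ∀ x ∈ V, f x = 0)
    {x : CTensor 𝕜 B X} (hx : x ∈ cSub 𝕜 B V) : cMap B f x = 0 :=
  (cMap_congr_of_mem_cSub (g := 0) h hx).trans (cMap_zero x)

/-- A linear complement gives a projection `π` onto `V`. The submodule is the fixed set of the
completion of `π`, and fixed sets of filtered maps are closed. -/
theorem isAdicClosed_cSub [IsNoetherianRing B] (V : Submodule 𝕜 X) :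
    IsAdicClosed (cSub 𝕜 B V) := by
  obtain ⟨W, hW⟩ := exists_isCompl V
  set π : X →ₗ[𝕜] X := V.subtype ∘ₗ V.projectionOnto W hW with hπ
  have h1 : ∀ x ∈ V, π x = x := fun x hx => by
    simpa [hπ] using congrArg Subtype.val (Submodule.projectionOnto_apply_left hW ⟨x, hx⟩)
  have h2 : ∀ x, π x ∈ V := fun x => by simp [hπ]
  intro x hx
  suffices cMap B π x = x by
    rw [← this]
    exact cMap_mem_cSub_range π h2 x
  refine eq_of_forall_sub_mem_infPart fun K => ?_
  obtain ⟨y, hy, hxy⟩ := hx K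
  have h3 := sub_mem (linearMap_mem_infPart_of_mem (cMap B π) hxy) hxy
  rw [map_sub, cMap_eq_self_of_mem_cSub h1 hy] at h3
  simpa using h3

/-! #### Small perturbations of the identity -/

/-- In `x = T x - (T x - x)` the second term gains one power of `𝔪` over `x`, so membership improves
step by step up to `n`. With `T x = 0` this gives injectivity. -/
theorem mem_infPart_of_perturbation [IsNoetherianRing B]
    (T : CTensor 𝕜 B X →ₗ[B] CTensor 𝕜 B X)
    (hT : ∀ x, T x - x ∈ infPart 𝕜 B X 1) {n : ℕ} {x : CTensor 𝕜 B X}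
    (hx : T x ∈ infPart 𝕜 B X n) : x ∈ infPart 𝕜 B X n := by
  have key : ∀ m ≤ n, x ∈ infPart 𝕜 B X m := by
    intro m
    induction m with
    | zero => exact fun _ => mem_infPart_zero x
    | succ m ih =>
      intro hm
      have h1 : (T - (LinearMap.id : CTensor 𝕜 B X →ₗ[B] CTensor 𝕜 B X)) x ∈ infPart 𝕜 B X (1 + m) :=
        linearMap_mem_infPart _ hT (ih (by omega))
      have h2 := sub_mem (infPart_antitone hm hx) (infPart_antitone (by omega : m + 1 ≤ 1 + m) h1)
      simpa using h2
  exact key n le_rfl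

/-- A small perturbation of the identity is surjective, also on closed invariant submodules. -/
theorem exists_perturbation_eq [IsNoetherianRing B] (T : CTensor 𝕜 B X →ₗ[B] CTensor 𝕜 B X)
    (hT : ∀ x, T x - x ∈ infPart 𝕜 B X 1) {S : Submodule B (CTensor 𝕜 B X)}
    (hS : IsAdicClosed S) (hTS : ∀ x ∈ S, T x ∈ S) {y : CTensor 𝕜 B X} (hy : y ∈ S) :
    ∃ x ∈ S, T x = y := by
  set P : CTensor 𝕜 B X →ₗ[B] CTensor 𝕜 B X := LinearMap.id - T with hP
  have hP1 : ∀ x, P x ∈ infPart 𝕜 B X 1 := fun x => by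
    simpa [hP] using neg_mem (hT x)
  have hPn : ∀ n, (P ^ n) y ∈ infPart 𝕜 B X n := by
    intro n
    induction n with
    | zero => exact mem_infPart_zero _
    | succ n ih =>
      rw [pow_succ', Module.End.mul_apply, add_comm]
      exact linearMap_mem_infPart P hP1 ih
  have hPS : ∀ n, (P ^ n) y ∈ S := by
    intro n
    induction n with
    | zero => simpa using hy
    | succ n ih =>
      rw [pow_succ', Module.End.mul_apply]
      exact sub_mem ih (hTS _ ih)
  -- Neumann series: the preimage is `∑ (1 - T)ⁿ y`, and applying `T` makes the sum telescope to
  -- `y`.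
  obtain ⟨x, hx⟩ := exists_hasAdicSum (fun n => (P ^ n) y) 0 (by simpa using hPn)
  refine ⟨x, hx.mem hS hPS, ?_⟩
  have h1 := hx.map T
  refine h1.unique fun K => ⟨K, fun n hn => ?_⟩
  have h2 : ∀ i, T ((P ^ i) y) = (P ^ i) y - (P ^ (i + 1)) y := by
    intro i
    rw [pow_succ', Module.End.mul_apply]
    simp [hP]
  simp_rw [h2]
  rw [Finset.sum_range_sub' (fun i => (P ^ i) y)]
  simpa using infPart_antitone hn (hPn n)

end CompletedTensorLemmas

/-! ### Combinatorics of inserting a family into composable sequences -/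

section Shuffles

open Finset.HasAntidiagonal (antidiagonal)
open Finset.Nat (sum_antidiagonal_succ)

variable {Ob : Type u} {V : Ob → Ob → Type v} {A : Type w}

/-- The sum of the values of `F` on all sequences of length `l` that arise from `p` by insertion of
elements of the family `r`. -/
def shuffleSum [AddCommMonoid A] (r : ∀ X : Ob, V X X) :
    ℕ → {X Y : Ob} → (p : Chain V X Y) → (Chain V X Y → A) → A
  | 0, _, _, .nil X, F => F (.nil X)
  | 0, _, _, .cons _ _, _ => 0
  | l + 1, _, _, .nil X, F => shuffleSum r l (.nil X) fun q => F (.cons (r X) q)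
  | l + 1, X, _, .cons a p, F =>
      shuffleSum r l (.cons a p) (fun q => F (.cons (r X) q)) +
        shuffleSum r l p fun q => F (.cons a q)

/-- The sum of the values of `F` on all splittings of `p` into two parts. -/
def splitSum [AddCommMonoid A] {X Y : Ob} (p : Chain V X Y)
    (F : ∀ M : Ob, Chain V X M → Chain V M Y → A) : A :=
  (p.splits.map fun s => F s.1 s.2.1 s.2.2).sum

section Monoid

variable [AddCommMonoid A] (r : ∀ X : Ob, V X X)

@[simp] theorem shuffleSum_zero_nil (X : Ob) (F : Chain V X X → A) :
    shuffleSum r 0 (.nil X) F = F (.nil X) := rfl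

@[simp] theorem shuffleSum_zero_cons {X Y Z : Ob} (a : V X Y) (p : Chain V Y Z)
    (F : Chain V X Z → A) : shuffleSum r 0 (.cons a p) F = 0 := rfl

theorem shuffleSum_succ_nil (l : ℕ) (X : Ob) (F : Chain V X X → A) :
    shuffleSum r (l + 1) (.nil X) F = shuffleSum r l (.nil X) fun q => F (.cons (r X) q) := rfl

theorem shuffleSum_succ_cons (l : ℕ) {X Y Z : Ob} (a : V X Y) (p : Chain V Y Z)
    (F : Chain V X Z → A) : shuffleSum r (l + 1) (.cons a p) F =
      shuffleSum r l (.cons a p) (fun q => F (.cons (r X) q)) +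
        shuffleSum r l p fun q => F (.cons a q) := rfl

@[simp] theorem splitSum_nil (X : Ob) (F : ∀ M : Ob, Chain V X M → Chain V M X → A) :
    splitSum (.nil X) F = F X (.nil X) (.nil X) := by
  simp [splitSum, Chain.splits]

theorem splitSum_cons {X Y Z : Ob} (a : V X Y) (p : Chain V Y Z)
    (F : ∀ M : Ob, Chain V X M → Chain V M Z → A) :
    splitSum (.cons a p) F =
      F X (.nil X) (.cons a p) + splitSum p fun M s t => F M (.cons a s) t := by
  simp only [splitSum, Chain.splits, List.map_cons, List.map_map, List.sum_cons]
  rfl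

theorem splitSum_zero {X Y : Ob} (p : Chain V X Y) :
    splitSum p (fun _ _ _ => (0 : A)) = 0 := by
  simp [splitSum]

theorem splitSum_add {X Y : Ob} (p : Chain V X Y)
    (F G : ∀ M : Ob, Chain V X M → Chain V M Y → A) :
    splitSum p (fun M s t => F M s t + G M s t) = splitSum p F + splitSum p G := by
  simp [splitSum, List.sum_map_add]

theorem splitSum_sum {X Y : Ob} (p : Chain V X Y) {ι : Type*} (S : Finset ι)
    (F : ι → ∀ M : Ob, Chain V X M → Chain V M Y → A) :
    splitSum p (fun M s t => ∑ i ∈ S, F i M s t) = ∑ i ∈ S, splitSum p (F i) := by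
  classical
  induction S using Finset.induction_on with
  | empty => simp [splitSum_zero]
  | insert i S hi ih => simp only [Finset.sum_insert hi, splitSum_add, ih]

theorem shuffleSum_zero_fun (l : ℕ) {X Y : Ob} (p : Chain V X Y) :
    shuffleSum r l p (fun _ => (0 : A)) = 0 := by
  induction l generalizing X Y with
  | zero => cases p <;> rfl
  | succ l ih => cases p <;> simp [shuffleSum_succ_nil, shuffleSum_succ_cons, ih]

theorem shuffleSum_add (l : ℕ) {X Y : Ob} (p : Chain V X Y) (F G : Chain V X Y → A) :
    shuffleSum r l p (fun q => F q + G q) = shuffleSum r l p F + shuffleSum r l p G := by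
  induction l generalizing X Y with
  | zero => cases p <;> simp
  | succ l ih =>
    cases p with
    | nil => simp only [shuffleSum_succ_nil, ih]
    | cons a p => simp only [shuffleSum_succ_cons, ih]; abel

theorem shuffleSum_sum (l : ℕ) {X Y : Ob} (p : Chain V X Y) {ι : Type*} (S : Finset ι)
    (F : ι → Chain V X Y → A) :
    shuffleSum r l p (fun q => ∑ i ∈ S, F i q) = ∑ i ∈ S, shuffleSum r l p (F i) := by
  classical
  induction S using Finset.induction_on with
  | empty => simp [shuffleSum_zero_fun]
  | insert i S hi ih => simp only [Finset.sum_insert hi, shuffleSum_add, ih]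

theorem map_shuffleSum {A' : Type*} [AddCommMonoid A'] (φ : A →+ A') (l : ℕ) {X Y : Ob}
    (p : Chain V X Y) (F : Chain V X Y → A) :
    φ (shuffleSum r l p F) = shuffleSum r l p fun q => φ (F q) := by
  induction l generalizing X Y with
  | zero => cases p <;> simp
  | succ l ih =>
    cases p with
    | nil => simp only [shuffleSum_succ_nil, ih]
    | cons a p => simp only [shuffleSum_succ_cons, map_add, ih]

theorem shuffleSum_comm (i j : ℕ) {X Y X' Y' : Ob} (p : Chain V X Y) (p' : Chain V X' Y')
    (F : Chain V X Y → Chain V X' Y' → A) :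
    shuffleSum r i p (fun q => shuffleSum r j p' (F q)) =
      shuffleSum r j p' fun q' => shuffleSum r i p fun q => F q q' := by
  induction i generalizing X Y with
  | zero => cases p <;> simp [shuffleSum_zero_fun]
  | succ l ih =>
    cases p with
    | nil => simp only [shuffleSum_succ_nil]; rw [ih]
    | cons a p => simp only [shuffleSum_succ_cons, shuffleSum_add]; rw [ih, ih]

theorem shuffleSum_of_lt_length {l : ℕ} {X Y : Ob} {p : Chain V X Y} (h : l < p.length)
    (F : Chain V X Y → A) : shuffleSum r l p F = 0 := by
  induction l generalizing X Y with
  | zero => cases p with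
    | nil => simp [Chain.length] at h
    | cons a p => rfl
  | succ l ih =>
    cases p with
    | nil => simp [Chain.length] at h
    | cons a p =>
      simp only [Chain.length] at h
      rw [shuffleSum_succ_cons, ih (by simp only [Chain.length]; omega), ih (by omega), add_zero]

theorem shuffleSum_length {X Y : Ob} (p : Chain V X Y)
    (F : Chain V X Y → A) : shuffleSum r p.length p F = F p := by
  induction p with
  | nil X => rfl
  | cons a p ih =>
    rw [Chain.length, shuffleSum_succ_cons,
      shuffleSum_of_lt_length r (by simp [Chain.length]), ih, zero_add]

/-- Splittings of a shuffle are pairs of shuffles of the parts of a splitting. -/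
theorem shuffleSum_splitSum (l : ℕ) {X Y : Ob} (p : Chain V X Y)
    (F : ∀ M : Ob, Chain V X M → Chain V M Y → A) :
    shuffleSum r l p (fun q => splitSum q F) =
      splitSum p fun M s t => ∑ ij ∈ antidiagonal l,
        shuffleSum r ij.1 s fun s' => shuffleSum r ij.2 t fun t' => F M s' t' := by
  induction l generalizing X Y with
  | zero =>
    cases p with
    | nil => simp
    | cons a p => simp [splitSum_cons, splitSum_zero]
  | succ l ih =>
    cases p with
    | nil =>
      simp only [shuffleSum_succ_nil, splitSum_cons, shuffleSum_add, ih, splitSum_nil,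
        sum_antidiagonal_succ, shuffleSum_zero_nil]
    | cons a p =>
      simp only [shuffleSum_succ_cons, splitSum_cons, shuffleSum_add, ih,
        sum_antidiagonal_succ, shuffleSum_zero_nil, shuffleSum_zero_cons,
        shuffleSum_succ_nil, Finset.sum_add_distrib, splitSum_add, splitSum_zero]
      abel

theorem shuffleSum_zero_append_cons {X Y Z T : Ob} (s : Chain V X Y) (b : V Y Z)
    (t : Chain V Z T) (F : Chain V X T → A) :
    shuffleSum r 0 (s.append (.cons b t)) F = 0 := by
  cases s <;> simp [Chain.append]

/-- Shuffles of a sequence with a marked entry are pairs of shuffles of the parts before and behind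
that entry. -/
theorem shuffleSum_append_cons (l : ℕ) {X Y Z T : Ob} (s : Chain V X Y) (b : V Y Z)
    (t : Chain V Z T) (F : Chain V X T → A) :
    shuffleSum r (l + 1) (s.append (.cons b t)) F = ∑ ij ∈ antidiagonal l,
      shuffleSum r ij.1 s fun s' => shuffleSum r ij.2 t fun t' => F (s'.append (.cons b t')) := by
  induction l generalizing X Y with
  | zero => cases s <;> simp [Chain.append, shuffleSum_succ_cons, shuffleSum_zero_append_cons]
  | succ l ih =>
    cases s with
    | nil =>
      have h := ih (.nil X) b fun q => F (.cons (r X) q)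
      simp only [Chain.append] at h ⊢
      rw [shuffleSum_succ_cons, h, sum_antidiagonal_succ, add_comm]
      rfl
    | cons a s =>
      have h := ih (.cons a s) b fun q => F (.cons (r X) q)
      have h' := ih s b fun q => F (.cons a q)
      simp only [Chain.append] at h h' ⊢
      rw [shuffleSum_succ_cons, h, h', sum_antidiagonal_succ, ← Finset.sum_add_distrib]
      simp [shuffleSum_succ_cons, Chain.append]

/-! #### Weights -/

/-- The sum of the weights of the entries of a sequence. -/
def Chain.weight {M : Type*} [AddCommMonoid M] (wt : ∀ X Y : Ob, V X Y → M) :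
    {X Y : Ob} → Chain V X Y → M
  | _, _, .nil _ => 0
  | _, _, .cons a p => wt _ _ a + Chain.weight wt p

/-- Inserted entries have weight zero, so every shuffle has the weight of `p`. In the application
the weight is the reduced degree, for which `‖r‖ = 0`. -/
theorem shuffleSum_mem {M : Type*} [AddCommMonoid M] (wt : ∀ X Y : Ob, V X Y → M)
    (hr : ∀ X, wt X X (r X) = 0) (S : AddSubmonoid A) (l : ℕ) {X Y : Ob} (p : Chain V X Y)
    (F : Chain V X Y → A) (h : ∀ q, q.weight wt = p.weight wt → F q ∈ S) :
    shuffleSum r l p F ∈ S := by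
  induction l generalizing X Y with
  | zero => cases p with
    | nil X => exact h _ rfl
    | cons a p => exact zero_mem _
  | succ l ih =>
    cases p with
    | nil X =>
      exact ih _ _ fun q hq => h _ (by simpa [Chain.weight, hr] using hq)
    | cons a p =>
      exact add_mem (ih _ _ fun q hq => h _ (by simpa [Chain.weight, hr] using hq))
        (ih _ _ fun q hq => h _ (by simp [Chain.weight, hq]))

theorem shuffleSum_congr_weight {M : Type*} [AddCommMonoid M] (wt : ∀ X Y : Ob, V X Y → M)
    (hr : ∀ X, wt X X (r X) = 0) (l : ℕ) {X Y : Ob} (p : Chain V X Y)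
    (F G : Chain V X Y → A) (h : ∀ q, q.weight wt = p.weight wt → F q = G q) :
    shuffleSum r l p F = shuffleSum r l p G := by
  induction l generalizing X Y with
  | zero => cases p with
    | nil X => exact h _ rfl
    | cons a p => rfl
  | succ l ih =>
    cases p with
    | nil X =>
      exact ih _ _ _ fun q hq => h _ (by simpa [Chain.weight, hr] using hq)
    | cons a p =>
      rw [shuffleSum_succ_cons, shuffleSum_succ_cons,
        ih _ _ _ fun q hq => h _ (by simpa [Chain.weight, hr] using hq),
        ih _ _ _ fun q hq => h _ (by simp [Chain.weight, hq])]

theorem shuffleSum_congr (l : ℕ) {X Y : Ob} (p : Chain V X Y)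
    (F G : Chain V X Y → A) (h : ∀ q, q.length = l → F q = G q) :
    shuffleSum r l p F = shuffleSum r l p G := by
  induction l generalizing X Y with
  | zero => cases p with
    | nil X => exact h _ rfl
    | cons a p => rfl
  | succ l ih =>
    cases p with
    | nil X =>
      exact ih _ _ _ fun q hq => h _ (by simp [Chain.length, hq])
    | cons a p =>
      rw [shuffleSum_succ_cons, shuffleSum_succ_cons,
        ih _ _ _ fun q hq => h _ (by simp [Chain.length, hq]),
        ih _ _ _ fun q hq => h _ (by simp [Chain.length, hq])]

/-! #### Entrywise maps that fix the objects -/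

/-- Apply a map to each entry of a sequence. -/
def Chain.mapHom {W : Ob → Ob → Type k} (φ : ∀ X Y : Ob, V X Y → W X Y) :
    {X Y : Ob} → Chain V X Y → Chain W X Y
  | _, _, .nil X => .nil X
  | _, _, .cons a p => .cons (φ _ _ a) (Chain.mapHom φ p)

theorem Chain.length_mapHom {W : Ob → Ob → Type k} (φ : ∀ X Y : Ob, V X Y → W X Y) {X Y : Ob}
    (p : Chain V X Y) : (p.mapHom φ).length = p.length := by
  induction p with
  | nil => rfl
  | cons a p ih => simp [Chain.length, Chain.mapHom, ih]

theorem shuffleSum_mapHom {W : Ob → Ob → Type k} (φ : ∀ X Y : Ob, V X Y → W X Y)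
    (l : ℕ) {X Y : Ob} (p : Chain V X Y) (F : Chain W X Y → A) :
    shuffleSum (fun X => φ X X (r X)) l (p.mapHom φ) F =
      shuffleSum r l p fun q => F (q.mapHom φ) := by
  induction l generalizing X Y with
  | zero => cases p <;> rfl
  | succ l ih =>
    cases p with
    | nil => exact ih (.nil _) _
    | cons a p =>
      simp only [Chain.mapHom, shuffleSum_succ_cons]
      rw [← ih p fun q => F (.cons (φ _ _ a) q),
        ← ih (.cons a p) fun q => F (.cons (φ _ _ (r _)) q)]
      rfl

theorem splitSum_mapHom {W : Ob → Ob → Type k} (φ : ∀ X Y : Ob, V X Y → W X Y)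
    {X Y : Ob} (p : Chain V X Y) (F : ∀ M : Ob, Chain W X M → Chain W M Y → A) :
    splitSum (p.mapHom φ) F = splitSum p fun M s t => F M (s.mapHom φ) (t.mapHom φ) := by
  induction p with
  | nil => simp [Chain.mapHom]
  | cons a p ih => simp only [splitSum_cons, Chain.mapHom, ih]

/-! #### Other descriptions of shuffles -/

theorem sum_antidiagonalTuple_succ (k n : ℕ) (f : (Fin (k + 1) → ℕ) → A) :
    ∑ x ∈ Finset.Nat.antidiagonalTuple (k + 1) n, f x =
      ∑ ij ∈ antidiagonal n, ∑ x ∈ Finset.Nat.antidiagonalTuple k ij.2, f (Fin.cons ij.1 x) := by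
  rw [Finset.sum_sigma']
  refine Finset.sum_bij' (fun x _ => ⟨(x 0, ∑ i : Fin k, x i.succ), Fin.tail x⟩)
    (fun y _ => Fin.cons y.1.1 y.2) ?_ ?_ ?_ ?_ ?_
  · intro x hx
    rw [Finset.Nat.mem_antidiagonalTuple, Fin.sum_univ_succ] at hx
    simp [Finset.HasAntidiagonal.mem_antidiagonal, Finset.Nat.mem_antidiagonalTuple, Fin.tail, hx]
  · rintro ⟨⟨i, j⟩, y⟩ hy
    simp only [Finset.mem_sigma, Finset.HasAntidiagonal.mem_antidiagonal, Finset.Nat.mem_antidiagonalTuple] at hy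
    simp [Finset.Nat.mem_antidiagonalTuple, Fin.sum_univ_succ, hy]
  · intro x hx
    simp
  · rintro ⟨⟨i, j⟩, y⟩ hy
    simp only [Finset.mem_sigma, Finset.HasAntidiagonal.mem_antidiagonal, Finset.Nat.mem_antidiagonalTuple] at hy
    simp [hy]
  · intro x hx
    simp

theorem shuffleSum_nil (l : ℕ) (X : Ob) (F : Chain V X X → A) :
    shuffleSum r l (.nil X) F = F (Chain.replicate (r X) l) := by
  induction l generalizing F with
  | zero => rfl
  | succ l ih => exact ih _

theorem shuffleSum_add_length_cons (j : ℕ) {X Y Z : Ob} (a : V X Y) (p : Chain V Y Z)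
    (F : Chain V X Z → A) :
    shuffleSum r (j + (p.length + 1)) (.cons a p) F = ∑ il ∈ antidiagonal j,
      shuffleSum r (il.2 + p.length) p
        fun q => F ((Chain.replicate (r X) il.1).append (.cons a q)) := by
  induction j generalizing F with
  | zero =>
    rw [zero_add, shuffleSum_succ_cons, shuffleSum_of_lt_length r (by simp [Chain.length])]
    simp [Chain.replicate, Chain.append]
  | succ j ih =>
    rw [show j + 1 + (p.length + 1) = (j + (p.length + 1)) + 1 by omega, shuffleSum_succ_cons, ih,
      sum_antidiagonal_succ, add_comm, show j + (p.length + 1) = j + 1 + p.length by omega]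
    rfl

/-- Translates the insertion numbers `n₀, …, nₖ` into `shuffleSum`, which counts by total length and
therefore satisfies simpler recursions: `j` insertions into `p` produce length `j + p.length`. -/
theorem sum_embrace (j : ℕ) {X Y : Ob} (p : Chain V X Y) (F : Chain V X Y → A) :
    ∑ n ∈ Finset.Nat.antidiagonalTuple (p.length + 1) j, F (p.embrace r n) =
      shuffleSum r (j + p.length) p F := by
  induction p generalizing j with
  | nil X =>
    simp only [Chain.length, add_zero, shuffleSum_nil]
    exact (congrArg (fun S => Finset.sum S fun n => F ((Chain.nil X).embrace r n))
      (Finset.Nat.antidiagonalTuple_one j)).trans (Finset.sum_singleton _ _)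
  | cons a p ih =>
    simp only [Chain.length]
    rw [sum_antidiagonalTuple_succ, shuffleSum_add_length_cons]
    refine Finset.sum_congr rfl fun il _ => ?_
    rw [← ih]
    rfl

end Monoid

end Shuffles

/-! ### Insertion and linearity in each entry -/

section EntryLinear

variable {R : Type k} [Semiring R] {Ob : Type u} {V : Ob → Ob → Type v} {A : Type w}
  [∀ X Y, AddCommMonoid (V X Y)] [∀ X Y, Module R (V X Y)] [AddCommMonoid A] [Module R A]

variable (R) in
/-- A function on the sequences from `X` to `Y` is linear in each entry. -/
def IsEntryLinear {X Y : Ob} (F : Chain V X Y → A) : Prop :=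
  ∀ (Z T : Ob) (s : Chain V X Z) (t : Chain V T Y),
    IsLinearMap R fun a : V Z T => F (s.append (.cons a t))

theorem IsMultilinear.isEntryLinear
    {μ : ∀ {X Y : Ob}, Chain V X Y → V X Y} (h : IsMultilinear R id μ) (X Y : Ob) :
    IsEntryLinear R fun p : Chain V X Y => μ p :=
  fun Z T s t => h X Z T Y s t

theorem IsEntryLinear.isMultilinear
    {μ : ∀ {X Y : Ob}, Chain V X Y → V X Y} (h : ∀ X Y, IsEntryLinear R fun p : Chain V X Y => μ p) :
    IsMultilinear R id μ :=
  fun X Y Z T p q => h X T Y Z p q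

theorem IsEntryLinear.cons {X Y Z : Ob} {F : Chain V X Z → A} (hF : IsEntryLinear R F)
    (a : V X Y) : IsEntryLinear R fun q => F (.cons a q) :=
  fun _ _ s t => hF _ _ (.cons a s) t

theorem IsEntryLinear.head {X Y Z : Ob} {F : Chain V X Z → A} (hF : IsEntryLinear R F)
    (q : Chain V Y Z) : IsLinearMap R fun a : V X Y => F (.cons a q) :=
  hF _ _ (.nil X) q

theorem isLinearMap_shuffleSum {M : Type*} [AddCommMonoid M] [Module R M] (r : ∀ X : Ob, V X X)
    (l : ℕ) {X Y : Ob} (p : Chain V X Y) (g : M → Chain V X Y → A)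
    (hg : ∀ q, IsLinearMap R fun a => g a q) :
    IsLinearMap R fun a => shuffleSum r l p (g a) where
  map_add a b := by
    rw [← shuffleSum_add]
    congr 1
    exact funext fun q => (hg q).map_add a b
  map_smul c a := by
    have h := map_shuffleSum r (DistribSMul.toAddMonoidHom A c) l p (g a)
    refine Eq.trans ?_ h.symm
    congr 1
    exact funext fun q => (hg q).map_smul c a

theorem isLinearMap_sum {M ι : Type*} [AddCommMonoid M] [Module R M] (S : Finset ι)
    (g : ι → M → A) (hg : ∀ i, IsLinearMap R (g i)) :
    IsLinearMap R fun a => ∑ i ∈ S, g i a where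
  map_add a b := by simp only [(hg _).map_add, Finset.sum_add_distrib]
  map_smul c a := by simp only [(hg _).map_smul, Finset.smul_sum]

theorem IsEntryLinear.shuffleSum (r : ∀ X : Ob, V X X) (l : ℕ) {X Y : Ob} {F : Chain V X Y → A}
    (hF : IsEntryLinear R F) : IsEntryLinear R fun q => shuffleSum r l q F := by
  intro Z T s t
  cases l with
  | zero =>
    simp only [shuffleSum_zero_append_cons]
    exact ⟨fun _ _ => (add_zero 0).symm, fun _ _ => (smul_zero _).symm⟩
  | succ l =>
    simp only [shuffleSum_append_cons]
    refine isLinearMap_sum _ _ fun ij => ?_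
    refine isLinearMap_shuffleSum r _ _ _ fun s' => ?_
    refine isLinearMap_shuffleSum r _ _ _ fun t' => ?_
    exact hF _ _ _ _

/-- Insertion of `r + r'` is insertion of `r'` followed by insertion of `r`. -/
theorem shuffleSum_add_family (r r' : ∀ X : Ob, V X X) (m L : ℕ) (hL : m < L) {X Y : Ob}
    (p : Chain V X Y) (F : Chain V X Y → A) (hF : IsEntryLinear R F) :
    shuffleSum (fun X => r X + r' X) m p F =
      ∑ l ∈ Finset.range L, shuffleSum r' l p fun q => shuffleSum r m q F := by
  -- Here `l` is the length after inserting `r'`. Terms with `l > m` vanish, so any `L > m` serves;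
  -- leaving `L` free lets the recursion use both `L` and `L + 1`.
  induction m generalizing X Y L with
  | zero =>
    obtain ⟨L, rfl⟩ := Nat.exists_eq_add_of_lt hL
    have hz : ∀ l, shuffleSum r' (l + 1) p (fun q => shuffleSum r 0 q F) = 0 := by
      intro l
      rw [shuffleSum_congr r' (l + 1) p _ (fun _ => 0), shuffleSum_zero_fun]
      exact fun q hq => shuffleSum_of_lt_length r (by omega) F
    rw [zero_add, Finset.sum_range_succ', Finset.sum_eq_zero fun l _ => hz l, zero_add]
    cases p <;> rfl
  | succ m ih =>
    obtain ⟨L, rfl⟩ := Nat.exists_eq_add_of_lt (Nat.zero_lt_of_lt hL)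
    rw [zero_add] at hL ⊢
    cases p with
    | nil =>
      have h1 : (fun q : Chain V X X => F (.cons (r X + r' X) q)) =
          fun q => F (.cons (r X) q) + F (.cons (r' X) q) :=
        funext fun q => (hF.head q).map_add _ _
      rw [shuffleSum_succ_nil, h1, shuffleSum_add, ih (L + 1) (by omega) _ _ (hF.cons _),
        ih L (by omega) _ _ (hF.cons _), Finset.sum_range_succ', Finset.sum_range_succ']
      simp only [shuffleSum_succ_nil, shuffleSum_succ_cons, shuffleSum_add, shuffleSum_zero_nil,
        Finset.sum_add_distrib]
      abel
    | cons a p =>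
      have h1 : (fun q => F (.cons (r X + r' X) q)) =
          fun q => F (.cons (r X) q) + F (.cons (r' X) q) :=
        funext fun q => (hF.head q).map_add _ _
      rw [shuffleSum_succ_cons, h1, shuffleSum_add, ih (L + 1) (by omega) _ _ (hF.cons _),
        ih L (by omega) _ _ (hF.cons _), ih L (by omega) _ _ (hF.cons _),
        Finset.sum_range_succ', Finset.sum_range_succ']
      simp only [shuffleSum_succ_cons, shuffleSum_add, shuffleSum_zero_cons,
        Finset.sum_add_distrib]
      abel

/-- Only cuttings into empty blocks and single entries survive. An empty block becomes an inserted
`r`, so `l` surviving blocks form a shuffle of length `l`; the induction peels off the first block.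
-/
theorem sum_partitions (r : ∀ X : Ob, V X X) (φ : ∀ X Y : Ob, Chain V X Y → V X Y)
    (h0 : ∀ X, φ X X (.nil X) = r X) (h1 : ∀ X Y (a : V X Y), φ X Y (.single a) = a)
    (h2 : ∀ X Y (p : Chain V X Y), 2 ≤ p.length → φ X Y p = 0) (l : ℕ) {X Y : Ob}
    (p : Chain V X Y) (F : Chain V X Y → A) (hF : IsEntryLinear R F) :
    ((p.partitions l).map fun Q => F (Q.mapHom φ)).sum = shuffleSum r l p F := by
  induction l generalizing X Y with
  | zero => cases p <;> simp [Chain.partitions, Chain.mapHom]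
  | succ l ih =>
    have hsplit : ((p.partitions (l + 1)).map fun Q => F (Q.mapHom φ)).sum =
        splitSum p fun M s t => shuffleSum r l t fun q => F (.cons (φ X M s) q) := by
      simp only [Chain.partitions, splitSum, List.flatMap, List.map_flatten, List.sum_flatten,
        List.map_map]
      congr 2
      funext s
      rw [← ih _ _ (hF.cons _)]
      simp only [Function.comp_apply, List.map_map]
      rfl
    rw [hsplit]
    cases p with
    | nil => rw [splitSum_nil, shuffleSum_succ_nil, h0]
    | cons a p =>
      rw [splitSum_cons, shuffleSum_succ_cons, h0]
      congr 1
      -- A first block with at least two entries puts a zero into a linear slot of `F`.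
      have hz : ∀ M M' b (s : Chain V _ M) (t : Chain V M _),
          shuffleSum r l t (fun q => F (.cons (φ X M (.cons a (.cons (Y := M') b s))) q)) = 0 := by
        intro M M' b s t
        rw [h2 _ _ _ (by simp [Chain.length])]
        simp only [(hF.head _).map_zero, shuffleSum_zero_fun]
      have h1' := h1 _ _ a
      rw [Chain.single] at h1'
      cases p with
      | nil => rw [splitSum_nil, h1']
      | cons b p => simp only [splitSum_cons, hz, splitSum_zero, add_zero, h1']

end EntryLinear

/-! ### Sequences of homogeneous elements -/

section Homogeneous

variable {Ob : Type u} {V : Ob → Ob → Type v} {N : ℕ} {R : Type w} [Ring R]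
  [∀ X Y, AddCommGroup (V X Y)] [∀ X Y, Module R (V X Y)]
  (gr : ∀ X Y : Ob, ZMod N → Submodule R (V X Y))

/-- Homogeneous elements together with a degree. -/
abbrev Homog (X Y : Ob) : Type v := {x : V X Y × ZMod N // x.1 ∈ gr X Y x.2}

/-- The underlying sequence of a sequence of homogeneous elements. -/
def Chain.val {X Y : Ob} (p : Chain (Homog gr) X Y) : Chain V X Y :=
  p.mapHom fun _ _ x => x.1.1

/-- The degrees of a sequence of homogeneous elements. -/
def Chain.degs : {X Y : Ob} → Chain (Homog gr) X Y → List (ZMod N)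
  | _, _, .nil _ => []
  | _, _, .cons a p => a.1.2 :: Chain.degs p

theorem Chain.hasDegrees_val {X Y : Ob} (p : Chain (Homog gr) X Y) :
    (p.val gr).HasDegrees gr (p.degs gr) := by
  induction p with
  | nil X => exact .nil X
  | cons a p ih => exact .cons a.2 ih

/-- An element such as `0` does not determine its degree, so degrees are carried as data. Inserting
the pair `(r, 1)` into such sequences then keeps track of degrees and signs automatically. -/
theorem Chain.HasDegrees.exists_homog {X Y : Ob} {p : Chain V X Y} {ds : List (ZMod N)}
    (h : p.HasDegrees gr ds) : ∃ q : Chain (Homog gr) X Y, q.val gr = p ∧ q.degs gr = ds := by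
  induction h with
  | nil X => exact ⟨.nil X, rfl, rfl⟩
  | @cons X Y Z a p d ds ha _ ih =>
    obtain ⟨q, rfl, rfl⟩ := ih
    exact ⟨.cons ⟨(a, d), ha⟩ q, rfl, rfl⟩

theorem redDeg_degs {X Y : Ob} (p : Chain (Homog gr) X Y) :
    redDeg (p.degs gr) = p.weight fun _ _ x => x.1.2 - 1 := by
  induction p with
  | nil X => rfl
  | cons a p ih => rw [Chain.weight, ← ih]; rfl

theorem Chain.degs_append {X Y Z : Ob} (p : Chain (Homog gr) X Y) (q : Chain (Homog gr) Y Z) :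
    (p.append q).degs gr = p.degs gr ++ q.degs gr := by
  induction p with
  | nil X => rfl
  | cons a p ih => simp [Chain.append, Chain.degs, ih]

theorem Chain.length_degs {X Y : Ob} (p : Chain (Homog gr) X Y) :
    (p.degs gr).length = p.length := by
  induction p with
  | nil X => rfl
  | cons a p ih => simp [Chain.degs, Chain.length, ih]

theorem splitSum_congr {W : Ob → Ob → Type v} {A : Type*} [AddCommMonoid A] {X Y : Ob}
    (p : Chain W X Y)
    (F G : ∀ M : Ob, Chain W X M → Chain W M Y → A)
    (h : ∀ M s t, s.append t = p → F M s t = G M s t) : splitSum p F = splitSum p G := by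
  induction p with
  | nil X => simp [h X (.nil X) (.nil X) rfl]
  | cons a p ih =>
    rw [splitSum_cons, splitSum_cons, h _ (.nil _) _ rfl]
    congr 1
    refine ih _ _ fun M s t hst => h _ _ _ ?_
    rw [Chain.append, hst]

theorem shuffleSum_splitSum_comm {W : Ob → Ob → Type v} {A : Type*} [AddCommMonoid A]
    (r : ∀ X : Ob, W X X) (l : ℕ) {X Y X' Y' : Ob} (s : Chain W X Y) (t : Chain W X' Y')
    (F : Chain W X Y → ∀ M, Chain W X' M → Chain W M Y' → A) :
    (shuffleSum r l s fun s' => splitSum t (F s')) =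
      splitSum t fun M t₁ t₂ => shuffleSum r l s fun s' => F s' M t₁ t₂ := by
  induction t with
  | nil => simp
  | cons a t ih => simp only [splitSum_cons, shuffleSum_add, ih]

theorem Chain.length_append {W : Ob → Ob → Type v} {X Y Z : Ob} (p : Chain W X Y)
    (q : Chain W Y Z) : (p.append q).length = p.length + q.length := by
  induction p with
  | nil => simp [Chain.append, Chain.length]
  | cons a p ih => simp [Chain.append, Chain.length, ih, Nat.add_right_comm]

/-- The sign now depends on the first part `s` alone, not on a prefix of an external list, which
puts the relation into the form to which `shuffleSum_splitSum` applies. -/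
theorem insertSum_val {A : Type*} [AddCommGroup A] {X Y : Ob} (G : Chain V X Y → A)
    (μ : ∀ {X Y : Ob}, Chain V X Y → V X Y) (p : Chain (Homog gr) X Y) :
    insertSum G μ (p.val gr) (p.degs gr) = splitSum p fun _ s t =>
      sgn (redDeg (s.degs gr)) • splitSum t fun _ t₁ t₂ =>
        G ((s.val gr).append (.cons (μ (t₁.val gr)) (t₂.val gr))) := by
  change splitSum (p.val gr) (fun _ s t => sgn (redDeg ((p.degs gr).take s.length)) •
      splitSum t fun _ t₁ t₂ => G (s.append (.cons (μ t₁) t₂))) = _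
  rw [Chain.val, splitSum_mapHom]
  refine splitSum_congr _ _ _ fun M s t hst => ?_
  have h : (p.degs gr).take (s.mapHom fun _ _ (x : Homog gr _ _) => x.1.1).length = s.degs gr := by
    rw [Chain.length_mapHom, ← Chain.length_degs gr s, ← hst, Chain.degs_append,
      List.take_left]
  rw [h, splitSum_mapHom]
  rfl

end Homogeneous

/-! ### Twisted products -/

section Twist

open Finset.HasAntidiagonal (antidiagonal mem_antidiagonal)

theorem sum_antidiagonal_rotate {A : Type*} [AddCommMonoid A] (f : ℕ → ℕ → ℕ → A) (n : ℕ) :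
    ∑ x ∈ antidiagonal n, ∑ y ∈ antidiagonal x.2, f y.1 x.1 y.2 =
      ∑ x ∈ antidiagonal n, ∑ y ∈ antidiagonal x.2, f x.1 y.1 y.2 := by
  rw [Finset.sum_sigma', Finset.sum_sigma']
  refine Finset.sum_bij' (fun z _ => ⟨(z.2.1, z.1.1 + z.2.2), (z.1.1, z.2.2)⟩)
    (fun z _ => ⟨(z.2.1, z.1.1 + z.2.2), (z.1.1, z.2.2)⟩) ?_ ?_ ?_ ?_ ?_
  all_goals
    rintro ⟨⟨a, b⟩, ⟨c, d⟩⟩ h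
    simp only [Finset.mem_sigma, mem_antidiagonal] at h
    obtain ⟨rfl, rfl⟩ := h
    simp [mem_antidiagonal, Nat.add_left_comm]

variable {𝕜 : Type k} [Field 𝕜] {N : ℕ} {Ob : Type u} {C : AInfCat.{u, v} 𝕜 N Ob}
  {B : Type w} [CommRing B] [IsLocalRing B] [Algebra 𝕜 B]

theorem hasAdicSum_antidiagonal {X : Type v} [AddCommGroup X] [Module 𝕜 X]
    (f : ℕ → ℕ → CTensor 𝕜 B X) (g : ℕ → CTensor 𝕜 B X)
    (x : CTensor 𝕜 B X) (hg : ∀ a, HasAdicSum 𝕜 B (f a) (g a)) (hx : HasAdicSum 𝕜 B g x)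
    (hf : ∀ K, ∃ n₀, ∀ a l, (n₀ ≤ a ∨ n₀ ≤ l) → f a l ∈ infPart 𝕜 B X K) :
    HasAdicSum 𝕜 B (fun n => ∑ p ∈ antidiagonal n, f p.1 p.2) x := by
  intro K
  obtain ⟨n₀, h⟩ := hasAdicSum_double f g x hg hx hf K
  -- For `n ≥ 2 * n₀` the triangle of pairs with sum below `n` contains the square of side `n₀`.
  refine ⟨2 * n₀, fun n hn => ?_⟩
  have h1 := h ((Finset.range n ×ˢ Finset.range n).filter fun p => p.1 + p.2 < n) (by
    intro p hp
    simp only [Finset.mem_product, Finset.mem_range, Finset.mem_filter] at hp ⊢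
    omega)
  rw [← Finset.sum_fiberwise_of_maps_to (t := Finset.range n) (g := fun p => p.1 + p.2)
    (by intro p hp; simp only [Finset.mem_filter, Finset.mem_range] at hp ⊢; exact hp.2)] at h1
  convert h1 using 2
  refine Finset.sum_congr rfl fun l hl => Finset.sum_congr ?_ fun _ _ => rfl
  ext p
  simp only [Finset.mem_product, Finset.mem_range, Finset.mem_filter, mem_antidiagonal] at hl ⊢
  omega

theorem HasAdicSum.eq_zero {X : Type v} [AddCommGroup X] [Module 𝕜 X]
    {f : ℕ → CTensor 𝕜 B X} {x : CTensor 𝕜 B X} (h : HasAdicSum 𝕜 B f x) (hf : ∀ n, f n = 0) :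
    x = 0 :=
  h.unique (by rw [funext hf]; exact hasAdicSum_zero)

/-- Each of the `l - p.length` inserted elements contributes a factor `𝔪^K` by linearity in its
slot. The exponent `n` absorbs the factors already gained during the recursion. -/
theorem shuffleSum_mem_infPart [IsNoetherianRing B] {E : Type v} [AddCommGroup E] [Module 𝕜 E]
    (r : ∀ X : Ob, C.HomQ B X X)
    (K : ℕ) (hr : ∀ X, r X ∈ infPart 𝕜 B (C.Hom X X) K) (l n : ℕ) {X Y : Ob}
    (p : Chain (C.HomQ B) X Y) (F : Chain (C.HomQ B) X Y → CTensor 𝕜 B E)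
    (hF : IsEntryLinear B F) (hn : ∀ q, q.length = l → F q ∈ infPart 𝕜 B E n) :
    shuffleSum r l p F ∈ infPart 𝕜 B E (n + K * (l - p.length)) := by
  induction l generalizing X Y n with
  | zero =>
    cases p with
    | nil => exact hn _ rfl
    | cons a p => exact zero_mem _
  | succ l ih =>
    have hr' : ∀ q, q.length = l → F (.cons (r X) q) ∈ infPart 𝕜 B E (n + K) := by
      intro q hq
      exact linearMap_mem_infPart ((hF.head q).mk' _) (fun a => hn _ (by rw [Chain.length, hq]))
        (hr X)
    cases p with
    | nil =>
      refine infPart_antitone ?_ (ih (n + K) (.nil X) _ (hF.cons _) hr')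
      simp only [Chain.length, Nat.sub_zero, mul_add]
      omega
    | cons a p =>
      rw [shuffleSum_succ_cons]
      refine add_mem (infPart_antitone ?_ (ih (n + K) (.cons a p) _ (hF.cons _) hr'))
        (infPart_antitone ?_ (ih n p _ (hF.cons _) fun q hq => hn _ (by rw [Chain.length, hq])))
      · simp only [Chain.length]
        rcases Nat.lt_or_ge l (p.length + 1) with h | h
        · rw [show l + 1 - (p.length + 1) = 0 by omega]
          omega
        · rw [show l + 1 - (p.length + 1) = (l - (p.length + 1)) + 1 by omega]
          simp only [mul_add]
          omega
      · simp only [Chain.length, Nat.add_sub_add_right, le_refl]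

theorem shuffleSum_mem_infPart_sub [IsNoetherianRing B] {E : Type v} [AddCommGroup E] [Module 𝕜 E]
    (r : ∀ X : Ob, C.HomQ B X X)
    (hr : ∀ X, r X ∈ infPart 𝕜 B (C.Hom X X) 1) (l : ℕ) {X Y : Ob}
    (p : Chain (C.HomQ B) X Y) (F : Chain (C.HomQ B) X Y → CTensor 𝕜 B E)
    (hF : IsEntryLinear B F) :
    shuffleSum r l p F ∈ infPart 𝕜 B E (l - p.length) := by
  simpa using shuffleSum_mem_infPart r 1 hr l 0 p F hF fun q _ => mem_infPart_zero _

theorem isEntryLinear_of_hasAdicSum [IsNoetherianRing B] {E : Type v} [AddCommGroup E] [Module 𝕜 E]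
    {X Y : Ob} (F : ℕ → Chain (C.HomQ B) X Y → CTensor 𝕜 B E)
    (G : Chain (C.HomQ B) X Y → CTensor 𝕜 B E) (hF : ∀ l, IsEntryLinear B (F l))
    (h : ∀ p, HasAdicSum 𝕜 B (fun l => F l p) (G p)) : IsEntryLinear B G := by
  intro Z T s t
  refine ⟨fun a b => (h _).unique ?_, fun c a => (h _).unique ?_⟩
  · simp only [(hF _ _ _ s t).map_add]
    exact (h _).add (h _)
  · simp only [(hF _ _ _ s t).map_smul]
    exact (h _).smul c

/-- The family `μ'` of products arises from `μ` by insertion of arbitrarily many copies of `r`. -/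
def IsTwist (r : ∀ X : Ob, C.HomQ B X X)
    (μ μ' : ∀ {X Y : Ob}, Chain (C.HomQ B) X Y → C.HomQ B X Y) : Prop :=
  ∀ (X Y : Ob) (p : Chain (C.HomQ B) X Y), HasAdicSum 𝕜 B (fun l => shuffleSum r l p μ) (μ' p)

theorem hasAdicSum_embrace_iff (r : ∀ X : Ob, C.HomQ B X X)
    (μ : ∀ {X Y : Ob}, Chain (C.HomQ B) X Y → C.HomQ B X Y) {X Y : Ob}
    (p : Chain (C.HomQ B) X Y) (x : C.HomQ B X Y) :
    HasAdicSum 𝕜 B (fun j => ∑ n ∈ Finset.Nat.antidiagonalTuple (p.length + 1) j,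
      μ (p.embrace r n)) x ↔ HasAdicSum 𝕜 B (fun l => shuffleSum r l p μ) x := by
  simp only [sum_embrace r _ p μ]
  exact ⟨fun h => h.shift p.length fun n hn => shuffleSum_of_lt_length r hn _,
    fun h => h.unshift p.length fun n hn => shuffleSum_of_lt_length r hn _⟩

variable {r : ∀ X : Ob, C.HomQ B X X} {μ μ' : ∀ {X Y : Ob}, Chain (C.HomQ B) X Y → C.HomQ B X Y}

theorem exists_isTwist [IsNoetherianRing B] (r : ∀ X : Ob, C.HomQ B X X)
    (hr : ∀ X, r X ∈ infPart 𝕜 B (C.Hom X X) 1)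
    (μ : ∀ {X Y : Ob}, Chain (C.HomQ B) X Y → C.HomQ B X Y) (hμ : IsMultilinear B id μ) :
    ∃ μ' : ∀ {X Y : Ob}, Chain (C.HomQ B) X Y → C.HomQ B X Y, IsTwist r μ μ' := by
  have h : ∀ (X Y : Ob) (p : Chain (C.HomQ B) X Y), ∃ x,
      HasAdicSum 𝕜 B (fun l => shuffleSum r l p μ) x := fun X Y p =>
    exists_hasAdicSum _ p.length fun l =>
      shuffleSum_mem_infPart_sub r hr l p _ (hμ.isEntryLinear X Y)
  choose μ' hμ' using h
  exact ⟨fun {X Y} p => μ' X Y p, hμ'⟩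

theorem IsTwist.isMultilinear [IsNoetherianRing B] (h : IsTwist r μ μ')
    (hμ : IsMultilinear B id μ) : IsMultilinear B id μ' :=
  IsEntryLinear.isMultilinear fun X Y => isEntryLinear_of_hasAdicSum _ _
    (fun l => (hμ.isEntryLinear X Y).shuffleSum r l) (h X Y)

theorem IsTwist.degree [IsNoetherianRing B] (h : IsTwist r μ μ')
    (hr : ∀ X, r X ∈ C.grQ B X X 1)
    (hμ : ∀ (X Y : Ob) (p : Chain (C.HomQ B) X Y) (ds : List (ZMod N)),
      p.HasDegrees (C.grQ B) ds → μ p ∈ C.grQ B X Y (redDeg ds + 2))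
    (X Y : Ob) (p : Chain (C.HomQ B) X Y) (ds : List (ZMod N))
    (hp : p.HasDegrees (C.grQ B) ds) : μ' p ∈ C.grQ B X Y (redDeg ds + 2) := by
  refine (h X Y p).mem (isAdicClosed_cSub _) fun l => ?_
  obtain ⟨q, rfl, rfl⟩ := hp.exists_homog
  have h1 := shuffleSum_mapHom (fun X => (⟨(r X, 1), hr X⟩ : Homog (C.grQ B) X X))
    (fun X Y (x : Homog (C.grQ B) X Y) => x.1.1) l q μ
  refine h1 ▸ shuffleSum_mem _ (fun _ _ x => x.1.2 - 1) (fun X => sub_self _)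
    (C.grQ B X Y (redDeg (q.degs (C.grQ B)) + 2)).toAddSubmonoid l q _ fun q' hq' => ?_
  have h2 := hμ X Y _ _ (q'.hasDegrees_val)
  rwa [redDeg_degs, hq', ← redDeg_degs] at h2

/-- The inner and the outer series are merged into one, indexed by the total length of the three
parts. Continuity of the outer product in the marked entry allows the inner series to be pulled out.
-/
theorem IsTwist.hasAdicSum_insert [IsNoetherianRing B] (h : IsTwist r μ μ')
    (hμ : IsMultilinear B id μ) (hr : ∀ X, r X ∈ infPart 𝕜 B (C.Hom X X) 1) {X Y Z T : Ob}
    (s : Chain (C.HomQ B) X Y) (t₁ : Chain (C.HomQ B) Y Z) (t₂ : Chain (C.HomQ B) Z T) :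
    HasAdicSum 𝕜 B (fun l => ∑ x ∈ antidiagonal l, ∑ y ∈ antidiagonal x.2,
        shuffleSum r x.1 s fun s' => shuffleSum r y.1 t₁ fun t₁' => shuffleSum r y.2 t₂ fun t₂' =>
          μ (s'.append (.cons (μ t₁') t₂')))
      (μ' (s.append (.cons (μ' t₁) t₂))) := by
  set x : ℕ → C.HomQ B Y Z := fun a => shuffleSum r a t₁ μ with hx
  -- The outer length is `m + 1` because the inner product occupies one entry; the omitted term of
  -- length `0` vanishes.
  set f : ℕ → ℕ → C.HomQ B X T := fun a m =>
    shuffleSum r (m + 1) (s.append (.cons (x a) t₂)) μ with hf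
  have hlin := (h.isMultilinear hμ) X Y Z T s t₂
  have hxa : ∀ a, x a ∈ infPart 𝕜 B (C.Hom Y Z) (a - t₁.length) := fun a =>
    shuffleSum_mem_infPart_sub r hr a t₁ _ (hμ.isEntryLinear Y Z)
  have key := hasAdicSum_antidiagonal f (fun a => μ' (s.append (.cons (x a) t₂))) _
    (fun a => (h _ _ _).unshift 1 fun n hn => by
      rw [Nat.lt_one_iff.mp hn, shuffleSum_zero_append_cons])
    ((h Y Z t₁).map (hlin.mk' _)) ?_
  · convert key using 2 with l
    · refine (sum_antidiagonal_rotate (fun i a b => shuffleSum r i s fun s' =>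
        shuffleSum r a t₁ fun t₁' => shuffleSum r b t₂ fun t₂' =>
          μ (s'.append (.cons (μ t₁') t₂'))) l).symm.trans ?_
      refine Finset.sum_congr rfl fun p _ => ?_
      simp only [hf, shuffleSum_append_cons]
      refine Finset.sum_congr rfl fun q _ => ?_
      congr 1
      funext s'
      rw [shuffleSum_comm]
      congr 1
      funext t₂'
      exact (map_shuffleSum r ((hμ X Y Z T s' t₂').mk' _).toAddMonoidHom _ t₁ _).symm
    · rfl
  · intro K
    -- Large `a` forces many insertions in the inner product, large `l` many in the outer one.
    refine ⟨K + t₁.length + s.length + t₂.length, fun a l hal => ?_⟩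
    rcases hal with hal | hal
    · have h1 := ((hμ.isEntryLinear X T).shuffleSum r (l + 1)) Y Z s t₂
      exact infPart_antitone (by omega) (linearMap_mem_infPart_of_mem (h1.mk' _) (hxa a))
    · refine infPart_antitone ?_
        (shuffleSum_mem_infPart_sub r hr (l + 1) _ _ (hμ.isEntryLinear X T))
      rw [Chain.length_append, Chain.length]
      omega

/-- For each `l`, the length-`l` part of the relation for `μ'` is the sum of the relations for `μ`
over all shuffles of length `l`: cutting a shuffle amounts to shuffling the pieces, and the signs
match because `‖r‖ = 0`. -/
theorem IsTwist.relation [IsNoetherianRing B] (h : IsTwist r μ μ')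
    (hμ : IsMultilinear B id μ) (hr : ∀ X, r X ∈ infPart 𝕜 B (C.Hom X X) 1)
    (hr1 : ∀ X, r X ∈ C.grQ B X X 1)
    (hrel : ∀ (X Y : Ob) (p : Chain (C.HomQ B) X Y) (ds : List (ZMod N)),
      p.HasDegrees (C.grQ B) ds → insertSum μ μ p ds = 0)
    (X Y : Ob) (p : Chain (C.HomQ B) X Y) (ds : List (ZMod N))
    (hp : p.HasDegrees (C.grQ B) ds) : insertSum μ' μ' p ds = 0 := by
  obtain ⟨q, rfl, rfl⟩ := hp.exists_homog
  set ρ : ∀ X, Homog (C.grQ B) X X := fun X => ⟨(r X, 1), hr1 X⟩ with hρ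
  rw [insertSum_val]
  have h1 : HasAdicSum 𝕜 B (fun l => splitSum q fun _ s t =>
      sgn (redDeg (s.degs (C.grQ B))) • splitSum t fun _ t₁ t₂ =>
        ∑ x ∈ antidiagonal l, ∑ y ∈ antidiagonal x.2,
          shuffleSum r x.1 (s.val _) fun s' => shuffleSum r y.1 (t₁.val _) fun t₁' =>
            shuffleSum r y.2 (t₂.val _) fun t₂' => μ (s'.append (.cons (μ t₁') t₂')))
      (splitSum q fun _ s t => sgn (redDeg (s.degs (C.grQ B))) • splitSum t fun _ t₁ t₂ =>
        μ' ((s.val (C.grQ B)).append (.cons (μ' (t₁.val (C.grQ B))) (t₂.val (C.grQ B))))) := by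
    refine hasAdicSum_list_sum _ _ _ fun st _ => HasAdicSum.zsmul _ ?_
    exact hasAdicSum_list_sum _ _ _ fun tt _ => h.hasAdicSum_insert hμ hr _ _ _
  refine h1.eq_zero fun l => ?_
  have h2 : shuffleSum ρ l q (fun q' => insertSum μ μ (q'.val _) (q'.degs _)) = 0 := by
    simp only [fun q' : Chain (Homog (C.grQ B)) X Y => hrel X Y _ _ (q'.hasDegrees_val (C.grQ B))]
    exact shuffleSum_zero_fun _ _ _
  simp only [insertSum_val] at h2
  rw [shuffleSum_splitSum] at h2
  refine Eq.trans ?_ h2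
  congr 1
  funext M s t
  have h3 : ∀ (i j : ℕ), (shuffleSum ρ i s fun s' => shuffleSum ρ j t fun t' =>
      sgn (redDeg (s'.degs (C.grQ B))) • splitSum t' fun _ t₁ t₂ =>
        μ ((s'.val (C.grQ B)).append (.cons (μ (t₁.val (C.grQ B))) (t₂.val (C.grQ B))))) =
      sgn (redDeg (s.degs (C.grQ B))) • splitSum t fun _ t₁ t₂ => ∑ y ∈ antidiagonal j,
        shuffleSum r i (s.val _) fun s' => shuffleSum r y.1 (t₁.val _) fun t₁' =>
          shuffleSum r y.2 (t₂.val _) fun t₂' => μ (s'.append (.cons (μ t₁') t₂')) := by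
    intro i j
    have h4 := fun (A : Type _) (inst : AddCommGroup A) (c : ℤ) =>
      fun {X Y : Ob} (i : ℕ) (p : Chain (Homog (C.grQ B)) X Y) (F : _ → A) =>
      map_shuffleSum ρ (DistribSMul.toAddMonoidHom A c) i p F
    simp only [DistribSMul.toAddMonoidHom_apply] at h4
    -- All shuffles of `s` have the reduced degree of `s`, so the sign can be taken out of the sum.
    rw [shuffleSum_congr_weight ρ (fun _ _ x => x.1.2 - 1) (fun X => sub_self _) i s _
      (fun s' => sgn (redDeg (s.degs (C.grQ B))) • shuffleSum ρ j t fun t' =>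
        splitSum t' fun _ t₁ t₂ =>
          μ ((s'.val (C.grQ B)).append (.cons (μ (t₁.val (C.grQ B))) (t₂.val (C.grQ B)))))
      (fun s' hs' => by rw [h4, redDeg_degs, hs', ← redDeg_degs])]
    rw [← h4]
    congr 1
    simp only [shuffleSum_splitSum]
    rw [shuffleSum_splitSum_comm]
    congr 1
    funext M' t₁ t₂
    rw [shuffleSum_sum]
    refine Finset.sum_congr rfl fun y _ => ?_
    have h6 := fun {X Y : Ob} (l : ℕ) (p : Chain (Homog (C.grQ B)) X Y)
      {A : Type _} [AddCommGroup A] (F : Chain (C.HomQ B) X Y → A) =>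
      shuffleSum_mapHom ρ (fun X Y (x : Homog (C.grQ B) X Y) => x.1.1) l p F
    simp only [Chain.val]
    rw [← h6 i s fun s' => shuffleSum ρ y.1 t₁ fun t₁' => shuffleSum ρ y.2 t₂ fun t₂' =>
      μ (s'.append (.cons (μ (t₁'.mapHom _)) (t₂'.mapHom _)))]
    congr 1
    funext s'
    rw [← h6 y.1 t₁ fun t₁' => shuffleSum ρ y.2 t₂ fun t₂' =>
      μ (s'.append (.cons (μ t₁') (t₂'.mapHom _)))]
    congr 1
    funext t₁'
    exact (h6 y.2 t₂ fun t₂' => μ (s'.append (.cons (μ t₁') t₂'))).symm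
  rw [Finset.sum_congr rfl fun ij _ => h3 ij.1 ij.2]
  rw [← Finset.smul_sum, splitSum_sum]

end Twist

/-! ### Uncurvings: existence, composition, curvature and gauge equivalence -/

section Uncurving

variable {𝕜 : Type k} [Field 𝕜] {N : ℕ} {Ob : Type u} {C : AInfCat.{u, v} 𝕜 N Ob}
  {B : Type w} [CommRing B] [IsLocalRing B] [Algebra 𝕜 B]
  {D D' D'' : Deformation C B} {r r' : ∀ X : Ob, C.HomQ B X X}

theorem isUncurving_iff : IsUncurving D r D' ↔ (∀ X, r X ∈ infPart 𝕜 B (C.Hom X X) 1) ∧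
    (∀ X, r X ∈ C.grQ B X X 1) ∧ IsTwist r D.μ D'.μ :=
  ⟨fun h => ⟨h.mem_infPart, h.mem_gr,
    fun X Y p => (hasAdicSum_embrace_iff r D.μ p _).mp (h.hasSum X Y p)⟩,
   fun h => ⟨h.1, h.2.1, fun X Y p => (hasAdicSum_embrace_iff r D.μ p _).mpr (h.2.2 X Y p)⟩⟩

theorem IsUncurving.isTwist (h : IsUncurving D r D') : IsTwist r D.μ D'.μ :=
  (isUncurving_iff.mp h).2.2

theorem IsUncurving.unique (h : IsUncurving D r D') (h' : IsUncurving D r D'') : D' = D'' :=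
  Deformation.ext (funext fun X => funext fun Y => funext fun p =>
    (h.isTwist X Y p).unique (h'.isTwist X Y p))

theorem AInfCat.length_inclChain {X Y : Ob} (p : Chain C.Hom X Y) :
    (C.inclChain B p).length = p.length := by
  induction p with
  | nil X => rfl
  | cons a p ih => exact congrArg (· + 1) ih

theorem exists_isUncurving [IsNoetherianRing B] (D : Deformation C B) {r : ∀ X : Ob, C.HomQ B X X}
    (hr : ∀ X, r X ∈ infPart 𝕜 B (C.Hom X X) 1) (hr1 : ∀ X, r X ∈ C.grQ B X X 1) :
    ∃ D' : Deformation C B, IsUncurving D r D' := by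
  have hμ := D.isCurvedAInf.multilinear
  obtain ⟨μ', h⟩ := exists_isTwist r hr D.μ hμ
  have hsub : ∀ (X Y : Ob) (p : Chain (C.HomQ B) X Y),
      μ' p - D.μ p ∈ infPart 𝕜 B (C.Hom X Y) 1 := by
    intro X Y p
    -- The first nonzero term is the one without insertions, of length `p.length`, and equals `D.μ
    -- p`; all later terms contain `r` and lie in `𝔪`.
    have h1 := (h X Y p).sub_sum (p.length + 1)
    rw [Finset.sum_range_succ, Finset.sum_eq_zero fun l hl =>
      shuffleSum_of_lt_length r (Finset.mem_range.mp hl) _, zero_add, shuffleSum_length] at h1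
    refine h1.mem (isAdicClosed_infPart 1) fun n => infPart_antitone ?_
      (shuffleSum_mem_infPart_sub r hr _ p _ (hμ.isEntryLinear X Y))
    omega
  refine ⟨⟨μ', ⟨h.isMultilinear hμ, h.degree hr1 D.isCurvedAInf.degree,
    h.relation hμ hr hr1 D.isCurvedAInf.relation⟩, fun X => ?_, fun X Y p => ?_⟩,
    isUncurving_iff.mpr ⟨hr, hr1, h⟩⟩
  · simpa using add_mem (hsub X X (.nil X)) (D.curvature_mem X)
  · simpa using add_mem (hsub X Y (C.inclChain B p)) (D.reduces X Y p)

theorem hasAdicSum_shuffleSum {E : Type v} [AddCommGroup E] [Module 𝕜 E]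
    (r : ∀ X : Ob, C.HomQ B X X) (l : ℕ) {X Y : Ob} (p : Chain (C.HomQ B) X Y)
    (F : ℕ → Chain (C.HomQ B) X Y → CTensor 𝕜 B E) (G : Chain (C.HomQ B) X Y → CTensor 𝕜 B E)
    (h : ∀ q, HasAdicSum 𝕜 B (fun n => F n q) (G q)) :
    HasAdicSum 𝕜 B (fun n => shuffleSum r l p (F n)) (shuffleSum r l p G) := by
  induction l generalizing X Y with
  | zero =>
    cases p with
    | nil X => exact h _
    | cons a p => exact hasAdicSum_zero
  | succ l ih =>
    cases p with
    | nil X => exact ih _ _ _ fun q => h _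
    | cons a p => exact (ih _ _ _ fun q => h _).add (ih _ _ _ fun q => h _)

/-- By linearity, inserting `r + r'` means inserting `r'` up to some length `l` and then `r` up to
length `m`. The iterated series may be summed over squares since its terms tend to zero in both
indices. -/
theorem IsUncurving.trans [IsNoetherianRing B] (h : IsUncurving D r D')
    (h' : IsUncurving D' r' D'') : IsUncurving D (r + r') D'' := by
  refine isUncurving_iff.mpr ⟨fun X => add_mem (h.mem_infPart X) (h'.mem_infPart X),
    fun X => add_mem (h.mem_gr X) (h'.mem_gr X), fun X Y p K => ?_⟩
  have hμ := D.isCurvedAInf.multilinear.isEntryLinear X Y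
  obtain ⟨n₀, hn⟩ := hasAdicSum_double
    (fun l m => shuffleSum r' l p fun q => shuffleSum r m q D.μ) _ _
    (fun l => hasAdicSum_shuffleSum r' l p _ _ fun q => h.isTwist X Y q) (h'.isTwist X Y p)
    (fun K => by
      refine ⟨K + p.length, fun l m hlm => ?_⟩
      -- There are no shuffles if `m < l`. Otherwise the `m - l` copies of `r` and the copies of
      -- `r'` together number at least `m - p.length`.
      rcases lt_or_ge m l with hml | hml
      · rw [shuffleSum_congr r' l p _ (fun _ => 0) fun q hq =>
          shuffleSum_of_lt_length r (by omega) _, shuffleSum_zero_fun]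
        exact zero_mem _
      · refine infPart_antitone ?_ (shuffleSum_mem_infPart r' 1 h'.mem_infPart l (m - l) p _
          (hμ.shuffleSum r m) fun q hq => hq ▸
            shuffleSum_mem_infPart_sub r h.mem_infPart m q _ hμ)
        omega) K
  refine ⟨n₀, fun n hn' => ?_⟩
  have h1 := hn (Finset.range n ×ˢ Finset.range n) (Finset.product_subset_product
    (Finset.range_mono hn') (Finset.range_mono hn'))
  rw [Finset.sum_product_right] at h1
  convert h1 using 2
  refine Finset.sum_congr rfl fun m hm => ?_
  exact shuffleSum_add_family r r' m n (Finset.mem_range.mp hm) p D.μ hμ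

/-- The omitted terms contain at least `c` copies of `r`. The case `c = 2` is the first-order
expansion of the curvature, whose quadratic error doubles the exponent in each optimization step. -/
theorem IsUncurving.curv_sub_mem [IsNoetherianRing B] (h : IsUncurving D r D') {K : ℕ}
    (hr : ∀ X, r X ∈ infPart 𝕜 B (C.Hom X X) K) (c : ℕ) (X : Ob) :
    D'.curv X - ∑ l ∈ Finset.range c, shuffleSum r l (.nil X) D.μ ∈
      infPart 𝕜 B (C.Hom X X) (K * c) := by
  refine ((h.isTwist X X (.nil X)).sub_sum c).mem (isAdicClosed_infPart _) fun n => ?_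
  refine infPart_antitone ?_ (shuffleSum_mem_infPart r K hr (n + c) 0 (.nil X) _
    (D.isCurvedAInf.multilinear.isEntryLinear X X) fun q _ => mem_infPart_zero _)
  rw [zero_add]
  exact Nat.mul_le_mul_left K (by simp [Chain.length])

theorem IsUncurving.curv_sub_curv_mem [IsNoetherianRing B] (h : IsUncurving D r D') {K : ℕ}
    (hr : ∀ X, r X ∈ infPart 𝕜 B (C.Hom X X) K) (X : Ob) :
    D'.curv X - D.curv X ∈ infPart 𝕜 B (C.Hom X X) K := by
  simpa [Deformation.curv] using h.curv_sub_mem hr 1 X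

theorem IsUncurving.curv_sub_curv_add_diff_mem [IsNoetherianRing B] (h : IsUncurving D r D')
    {K : ℕ} (hr : ∀ X, r X ∈ infPart 𝕜 B (C.Hom X X) K) (X : Ob) :
    D'.curv X - (D.curv X + D.diff (r X)) ∈ infPart 𝕜 B (C.Hom X X) (2 * K) := by
  have h1 := h.curv_sub_mem hr 2 X
  rw [Finset.sum_range_succ, Finset.sum_range_one, mul_comm] at h1
  exact h1

/-! #### The gauge equivalence of an uncurving -/

/-- The components of the functor with `F⁰ = r`, `F¹ = Id` and `Fᵏ = 0` for `k ≥ 2`. -/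
noncomputable def uncurvingComp (r : ∀ X : Ob, C.HomQ B X X) :
    {X Y : Ob} → Chain (C.HomQ B) X Y → C.HomQ B X Y
  | _, _, .nil X => r X
  | _, _, .cons a (.nil _) => a
  | _, _, .cons _ (.cons _ _) => 0

theorem uncurvingComp_of_two_le {X Y : Ob} {p : Chain (C.HomQ B) X Y} (h : 2 ≤ p.length) :
    uncurvingComp r p = 0 := by
  cases p with
  | nil => simp [Chain.length] at h
  | cons a p =>
    cases p with
    | nil => simp [Chain.length] at h
    | cons b p => rfl

theorem isMultilinear_uncurvingComp (r : ∀ X : Ob, C.HomQ B X X) :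
    IsMultilinear B id (uncurvingComp r) := by
  intro X Y Z T p q
  by_cases h : p.length + q.length = 0
  · cases p with
    | nil =>
      cases q with
      | nil => exact IsLinearMap.mk (fun _ _ => rfl) (fun _ _ => rfl)
      | cons b q => simp [Chain.length] at h
    | cons a p =>
      simp only [Chain.length] at h
      omega
  · have h0 : ∀ a : C.HomQ B Y Z, uncurvingComp r (p.append (.cons a q)) = 0 := fun a =>
      uncurvingComp_of_two_le (by rw [Chain.length_append, Chain.length]; omega)
    simp only [h0]
    exact ⟨fun _ _ => (add_zero 0).symm, fun _ _ => (smul_zero _).symm⟩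

theorem splitSum_uncurvingComp (r : ∀ X : Ob, C.HomQ B X X) {X Y Z : Ob}
    (p : Chain (C.HomQ B) Y Z) (μ : ∀ M, Chain (C.HomQ B) Y M → C.HomQ B X M) :
    splitSum p (fun M t₁ t₂ => uncurvingComp r (.cons (μ M t₁) t₂)) = μ Z p := by
  induction p with
  | nil => rw [splitSum_nil]; rfl
  | cons a p ih =>
    rw [splitSum_cons, uncurvingComp_of_two_le (by simp [Chain.length]), zero_add]
    exact ih fun M t => μ M (.cons a t)

/-- After insertion of a product the sequence is nonempty, so only the unary component contributes.
This leaves the single term in which the product takes all of `p`, with sign `1`. -/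
theorem insertSum_uncurvingComp (r : ∀ X : Ob, C.HomQ B X X)
    (μ : ∀ {X Y : Ob}, Chain (C.HomQ B) X Y → C.HomQ B X Y) {X Y : Ob}
    (p : Chain (C.HomQ B) X Y) (ds : List (ZMod N)) :
    insertSum (uncurvingComp r) μ p ds = μ p := by
  have hsgn : sgn (redDeg ([] : List (ZMod N))) = 1 := by
    simp [sgn, redDeg]
  change splitSum p (fun _ s t => sgn (redDeg (ds.take s.length)) •
      splitSum t fun _ t₁ t₂ => uncurvingComp r (s.append (.cons (μ t₁) t₂))) = _
  cases p with
  | nil =>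
    rw [splitSum_nil, Chain.length, List.take_zero, hsgn, one_smul]
    exact splitSum_uncurvingComp r _ fun _ q => μ q
  | cons a p =>
    rw [splitSum_cons, Chain.length, List.take_zero, hsgn, one_smul]
    have h1 : (splitSum p fun M s t => sgn (redDeg (ds.take (Chain.cons a s).length)) •
        splitSum t fun _ t₁ t₂ => uncurvingComp r ((Chain.cons a s).append (.cons (μ t₁) t₂))) =
        0 := by
      refine Eq.trans ?_ (splitSum_zero p)
      congr 1
      funext M s t
      refine (congrArg _ (Eq.trans ?_ (splitSum_zero t))).trans (smul_zero _)
      congr 1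
      funext M' t₁ t₂
      refine uncurvingComp_of_two_le ?_
      rw [Chain.length_append, Chain.length, Chain.length]
      omega
    rw [h1, add_zero]
    exact splitSum_uncurvingComp r _ fun _ q => μ q

theorem Chain.map_id_eq_mapHom {V : Ob → Ob → Type v} {W : Ob → Ob → Type w}
    (φ : ∀ X Y, V X Y → W X Y) {X Y : Ob} (p : Chain V X Y) : p.map id φ = p.mapHom φ := by
  induction p with
  | nil => rfl
  | cons a p ih => exact congrArg (Chain.cons _) ih

/-- The functor from the uncurving by `r` with `F⁰ = r`, `F¹ = Id` and `Fᵏ = 0` for `k ≥ 2`. -/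
noncomputable def IsUncurving.functor (h : IsUncurving D r D') : DefFunctor D' D id where
  comp p := uncurvingComp r p
  multilinear := isMultilinear_uncurvingComp r
  degree X Y p ds hp := by
    cases hp with
    | nil X => simpa [redDeg, uncurvingComp] using h.mem_gr X
    | @cons X Y Z a p d ds ha hp =>
      cases hp with
      | nil Y => simpa [redDeg, uncurvingComp] using ha
      | cons hb hp => exact zero_mem _
  comp_nil_mem := h.mem_infPart
  relation X Y p ds _ := by
    -- The terms with `l` blocks add up to the length-`l` term of the series defining the uncurving.
    have h1 : ∀ l, ((p.partitions l).map fun Q =>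
        D.μ (Q.map id fun X Y q => (uncurvingComp r q : C.HomQ B (id X) (id Y)))).sum =
          shuffleSum r l p D.μ := by
      intro l
      rw [← sum_partitions r (fun X Y q => uncurvingComp r q) (fun _ => rfl) (fun _ _ _ => rfl)
        (fun _ _ q hq => uncurvingComp_of_two_le hq) l p D.μ
        (D.isCurvedAInf.multilinear.isEntryLinear X Y)]
      refine congrArg List.sum (List.map_congr_left fun Q _ => ?_)
      exact congrArg D.μ (Chain.map_id_eq_mapHom _ Q)
    have h2 := h.isTwist X Y p
    rw [← funext h1] at h2
    exact (insertSum_uncurvingComp r D'.μ p ds).symm ▸ h2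

theorem IsUncurving.isGaugeEquivalence_functor (h : IsUncurving D r D') :
    h.functor.IsGaugeEquivalence where
  one X Y a := by
    change incl 𝕜 B a - incl 𝕜 B a ∈ _
    rw [sub_self]
    exact zero_mem _
  higher X Y p hp := by
    change uncurvingComp r (C.inclChain B p) ∈ _
    rw [uncurvingComp_of_two_le (by rwa [AInfCat.length_inclChain])]
    exact zero_mem _

end Uncurving

/-! ### Projections of an internal direct sum -/

section InternalProj

variable {𝕜 : Type k} [Field 𝕜] {E : Type v} [AddCommGroup E] [Module 𝕜 E] {ι : Type w}
  [DecidableEq ι] {A : ι → Submodule 𝕜 E}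

/-- The projection to a summand of an internal direct sum decomposition. -/
noncomputable def internalProj (h : DirectSum.IsInternal A) (i : ι) : E →ₗ[𝕜] E :=
  letI := h.chooseDecomposition
  (A i).subtype ∘ₗ DirectSum.component 𝕜 ι (fun i => A i) i ∘ₗ
    (DirectSum.decomposeLinearEquiv A).toLinearMap

theorem internalProj_mem (h : DirectSum.IsInternal A) (i : ι) (x : E) : internalProj h i x ∈ A i :=
  letI := h.chooseDecomposition
  (DirectSum.decompose A x i).2

theorem internalProj_same (h : DirectSum.IsInternal A) {i : ι} {x : E} (hx : x ∈ A i) :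
    internalProj h i x = x :=
  letI := h.chooseDecomposition
  DirectSum.decompose_of_mem_same A hx

theorem internalProj_ne (h : DirectSum.IsInternal A) {i j : ι} {x : E} (hx : x ∈ A j)
    (hij : j ≠ i) : internalProj h i x = 0 :=
  letI := h.chooseDecomposition
  DirectSum.decompose_of_mem_ne A hx hij

theorem sum_internalProj [Fintype ι] (h : DirectSum.IsInternal A) (x : E) :
    ∑ i, internalProj h i x = x := by
  have hx : x ∈ ⨆ i, A i := by rw [h.submodule_iSup_eq_top]; trivial
  induction hx using Submodule.iSup_induction' with
  | mem i x hx =>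
    rw [Finset.sum_eq_single i (fun j _ hj => internalProj_ne h hx hj.symm) (by simp),
      internalProj_same h hx]
  | zero => simp
  | add x y _ _ hx hy => simp only [map_add, Finset.sum_add_distrib, hx, hy]

theorem internalProj_mem_of_graded (h : DirectSum.IsInternal A) {V : Submodule 𝕜 E}
    (hV : V = ⨆ i, V ⊓ A i) (i : ι) {x : E} (hx : x ∈ V) : internalProj h i x ∈ V := by
  rw [hV] at hx
  induction hx using Submodule.iSup_induction' with
  | mem j x hx =>
    by_cases hij : j = i
    · subst hij
      rw [internalProj_same h hx.2]
      exact hx.1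
    · rw [internalProj_ne h hx.2 hij]
      exact zero_mem _
  | zero => simp
  | add x y _ _ hx hy => rw [map_add]; exact add_mem hx hy

end InternalProj

/-! ### The contraction of a homological splitting -/

section Contraction

variable {𝕜 : Type k} [Field 𝕜] {N : ℕ} {Ob : Type u} {C : AInfCat.{u, v} 𝕜 N Ob}

/-- The differential `μ¹`. -/
def AInfCat.diff (C : AInfCat.{u, v} 𝕜 N Ob) (X Y : Ob) : C.Hom X Y →ₗ[𝕜] C.Hom X Y :=
  (C.isCurvedAInf.multilinear X X Y Y (.nil X) (.nil Y)).mk' fun a => C.μ (Chain.single a)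

theorem AInfCat.diff_mem_gr {X Y : Ob} {d : ZMod N} {a : C.Hom X Y} (ha : a ∈ C.gr X Y d) :
    C.diff X Y a ∈ C.gr X Y (d + 1) := by
  have h := C.isCurvedAInf.degree X Y (.single a) [d] (.cons ha (.nil Y))
  have e : redDeg [d] + 2 = d + 1 := by simp [redDeg]; ring
  rwa [e] at h

theorem AInfCat.internalProj_diff (X Y : Ob) (e : ZMod N) (b : C.Hom X Y) :
    internalProj (C.isInternal X Y) e (C.diff X Y b) =
      C.diff X Y (internalProj (C.isInternal X Y) (e - 1) b) := by
  have hb : b ∈ ⨆ i, C.gr X Y i := by rw [(C.isInternal X Y).submodule_iSup_eq_top]; trivial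
  induction hb using Submodule.iSup_induction' with
  | mem c x hx =>
    by_cases hc : c + 1 = e
    · subst hc
      rw [internalProj_same _ (AInfCat.diff_mem_gr hx), add_sub_cancel_right,
        internalProj_same _ hx]
    · rw [internalProj_ne _ (AInfCat.diff_mem_gr hx) hc, internalProj_ne _ hx, map_zero]
      rintro rfl
      simp at hc
  | zero => simp
  | add x y _ _ hx hy => simp only [map_add, hx, hy]

/-- The projections to `H` and `R` of a homological splitting and the inverse `σ` of the
differential, extended by zero from `I`. -/
structure HomologicalSplitting.Contraction (S : HomologicalSplitting C) (X Y : Ob) where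
  πH : C.Hom X Y →ₗ[𝕜] C.Hom X Y
  πR : C.Hom X Y →ₗ[𝕜] C.Hom X Y
  σ : C.Hom X Y →ₗ[𝕜] C.Hom X Y
  πH_mem : ∀ x, πH x ∈ S.H X Y
  πR_mem : ∀ x, πR x ∈ S.R X Y
  σ_mem : ∀ x, σ x ∈ S.R X Y
  decomp : ∀ x, πH x + C.diff X Y (σ x) + πR x = x
  πH_H : ∀ x ∈ S.H X Y, πH x = x
  πR_H : ∀ x ∈ S.H X Y, πR x = 0
  σ_H : ∀ x ∈ S.H X Y, σ x = 0
  πH_R : ∀ x ∈ S.R X Y, πH x = 0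
  πR_R : ∀ x ∈ S.R X Y, πR x = x
  σ_R : ∀ x ∈ S.R X Y, σ x = 0
  πH_diff : ∀ x, πH (C.diff X Y x) = 0
  πR_diff : ∀ x, πR (C.diff X Y x) = 0
  σ_diff : ∀ x ∈ S.R X Y, σ (C.diff X Y x) = x
  πH_gr : ∀ d, ∀ x ∈ C.gr X Y d, πH x ∈ C.gr X Y d
  πR_gr : ∀ d, ∀ x ∈ C.gr X Y d, πR x ∈ C.gr X Y d
  σ_gr : ∀ d, ∀ x ∈ C.gr X Y d, σ x ∈ C.gr X Y (d - 1)

/-- The differential kills `H` and `I` and maps `R` bijectively onto `I`; `σ` is the inverse,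
preceded by the projection to `I`. The three projections commute with the degree projections because
`H` and `R` are graded and `I` is the image of a homogeneous map. -/
theorem HomologicalSplitting.nonempty_contraction (S : HomologicalSplitting C) (X Y : Ob) :
    Nonempty (S.Contraction X Y) := by
  set pr := internalProj (S.isInternal X Y) with hpr
  set d := C.diff X Y with hd
  have hI : ∀ a, a ∈ S.I X Y ↔ ∃ b, d b = a := S.mem_I_iff X Y
  have hK : ∀ a, d a = 0 ↔ a ∈ S.H X Y ⊔ S.I X Y := S.mu_eq_zero_iff X Y
  have hdI : ∀ a, d a ∈ S.I X Y := fun a => (hI _).mpr ⟨a, rfl⟩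
  have memH : ∀ x, pr 0 x ∈ S.H X Y := fun x => internalProj_mem (S.isInternal X Y) 0 x
  have memI : ∀ x, pr 1 x ∈ S.I X Y := fun x => internalProj_mem (S.isInternal X Y) 1 x
  have memR : ∀ x, pr 2 x ∈ S.R X Y := fun x => internalProj_mem (S.isInternal X Y) 2 x
  have sameH : ∀ x ∈ S.H X Y, pr 0 x = x := fun x hx => internalProj_same (i := 0) _ hx
  have sameI : ∀ x ∈ S.I X Y, pr 1 x = x := fun x hx => internalProj_same (i := 1) _ hx
  have sameR : ∀ x ∈ S.R X Y, pr 2 x = x := fun x hx => internalProj_same (i := 2) _ hx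
  have neH : ∀ i ≠ 0, ∀ x ∈ S.H X Y, pr i x = 0 :=
    fun i hi x hx => internalProj_ne (j := 0) _ hx hi.symm
  have neI : ∀ i ≠ 1, ∀ x ∈ S.I X Y, pr i x = 0 :=
    fun i hi x hx => internalProj_ne (j := 1) _ hx hi.symm
  have neR : ∀ i ≠ 2, ∀ x ∈ S.R X Y, pr i x = 0 :=
    fun i hi x hx => internalProj_ne (j := 2) _ hx hi.symm
  have hsum : ∀ x, pr 0 x + pr 1 x + pr 2 x = x := fun x => by
    have := sum_internalProj (S.isInternal X Y) x
    rwa [Fin.sum_univ_three] at this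
  have hdH : ∀ x, d (pr 0 x) = 0 := fun x => (hK _).mpr (Submodule.mem_sup_left (memH x))
  have hdI' : ∀ x, d (pr 1 x) = 0 := fun x => (hK _).mpr (Submodule.mem_sup_right (memI x))
  have hdR : ∀ x, d (pr 2 x) = d x := fun x => by
    conv_rhs => rw [← hsum x]
    rw [map_add, map_add, hdH, hdI', zero_add, zero_add]
  -- The kernel `H ⊕ I` of the differential meets `R` trivially.
  have hinj : LinearMap.ker (d ∘ₗ (S.R X Y).subtype) = ⊥ := by
    rw [LinearMap.ker_eq_bot']
    rintro ⟨x, hx⟩ hdx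
    obtain ⟨a, ha, b, hb, hab⟩ := Submodule.mem_sup.mp ((hK x).mp hdx)
    have h2 := sameR x hx
    rw [← hab, map_add, neH 2 (by decide) a ha, neI 2 (by decide) b hb, add_zero] at h2
    exact Subtype.ext (hab.symm.trans h2.symm)
  obtain ⟨g, hg⟩ := LinearMap.exists_leftInverse_of_injective _ hinj
  have hg' : ∀ x ∈ S.R X Y, (g (d x) : C.Hom X Y) = x := fun x hx =>
    congrArg Subtype.val (LinearMap.congr_fun hg ⟨x, hx⟩)
  set σ : C.Hom X Y →ₗ[𝕜] C.Hom X Y := (S.R X Y).subtype ∘ₗ g ∘ₗ pr 1 with hσ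
  have σmem : ∀ x, σ x ∈ S.R X Y := fun x => (g (pr 1 x)).2
  have σd : ∀ x ∈ S.R X Y, σ (d x) = x := fun x hx => by
    change (g (pr 1 (d x)) : C.Hom X Y) = x
    rw [sameI _ (hdI x), hg' x hx]
  have dσ : ∀ x, d (σ x) = pr 1 x := fun x => by
    obtain ⟨b, hb⟩ := (hI _).mp (memI x)
    change d (g (pr 1 x) : C.Hom X Y) = pr 1 x
    rw [← hb, ← hdR b, hg' _ (memR b)]
  have hpd : ∀ e x, pr 0 (internalProj (C.isInternal X Y) e x) =
        internalProj (C.isInternal X Y) e (pr 0 x) ∧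
      pr 1 (internalProj (C.isInternal X Y) e x) = internalProj (C.isInternal X Y) e (pr 1 x) ∧
      pr 2 (internalProj (C.isInternal X Y) e x) = internalProj (C.isInternal X Y) e (pr 2 x) := by
    intro e x
    have h0 := internalProj_mem_of_graded (C.isInternal X Y) (S.graded_H X Y) e (memH x)
    have h2 := internalProj_mem_of_graded (C.isInternal X Y) (S.graded_R X Y) e (memR x)
    have h1 : internalProj (C.isInternal X Y) e (pr 1 x) ∈ S.I X Y := by
      rw [← dσ, hd, AInfCat.internalProj_diff]
      exact hdI _
    have hx := congrArg (internalProj (C.isInternal X Y) e) (hsum x)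
    rw [map_add, map_add] at hx
    rw [← hx]
    simp only [map_add]
    rw [sameH _ h0, sameI _ h1, sameR _ h2, neH 1 (by decide) _ h0, neH 2 (by decide) _ h0,
      neI 0 (by decide) _ h1, neI 2 (by decide) _ h1, neR 0 (by decide) _ h2,
      neR 1 (by decide) _ h2]
    simp
  have grmem : ∀ i : Fin 3, (∀ e x, pr i (internalProj (C.isInternal X Y) e x) =
      internalProj (C.isInternal X Y) e (pr i x)) → ∀ e, ∀ x ∈ C.gr X Y e, pr i x ∈ C.gr X Y e := by
    intro i hi e x hx
    rw [← internalProj_same (C.isInternal X Y) hx, hi]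
    exact internalProj_mem _ _ _
  refine ⟨⟨pr 0, pr 2, σ, memH, memR, σmem, fun x => ?_, sameH, neH 2 (by decide), fun x hx => ?_,
    neR 0 (by decide), sameR, fun x hx => ?_, fun x => neI 0 (by decide) _ (hdI x),
    fun x => neI 2 (by decide) _ (hdI x), σd, grmem 0 fun e x => (hpd e x).1,
    grmem 2 fun e x => (hpd e x).2.2, fun e x hx => ?_⟩⟩
  · rw [dσ, hsum]
  · change (g (pr 1 x) : C.Hom X Y) = 0
    rw [neH 1 (by decide) x hx, map_zero, ZeroMemClass.coe_zero]
  · change (g (pr 1 x) : C.Hom X Y) = 0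
    rw [neR 1 (by decide) x hx, map_zero, ZeroMemClass.coe_zero]
  · have h1 := internalProj_mem_of_graded (C.isInternal X Y) (S.graded_R X Y) (e - 1) (σmem x)
    -- Both `σ x` and its part of degree `e - 1` lie in `R`, where the differential is injective, so
    -- equal differentials make `σ x` homogeneous.
    have h2 : d (internalProj (C.isInternal X Y) (e - 1) (σ x)) = d (σ x) := by
      rw [hd, ← AInfCat.internalProj_diff, ← hd, dσ]
      exact internalProj_same _ (grmem 1 (fun e x => (hpd e x).2.1) e x hx)
    have h3 := congrArg σ h2
    rw [σd _ h1, σd _ (σmem x)] at h3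
    rw [← h3]
    exact internalProj_mem _ _ _

end Contraction

/-! ### The deformed decomposition and the optimization procedure -/

section DeformedDecomposition

variable {𝕜 : Type k} [Field 𝕜] {N : ℕ} {Ob : Type u} {C : AInfCat.{u, v} 𝕜 N Ob}
  {B : Type w} [CommRing B] [IsLocalRing B] [Algebra 𝕜 B]

theorem incl_add {X : Type v} [AddCommGroup X] [Module 𝕜 X] (x y : X) :
    incl 𝕜 B (x + y) = incl 𝕜 B x + incl 𝕜 B y := by
  rw [incl, TensorProduct.tmul_add, map_add]
  rfl

/-- The deformed differential as a linear map. -/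
noncomputable def Deformation.diffₗ (D : Deformation C B) (X Y : Ob) :
    C.HomQ B X Y →ₗ[B] C.HomQ B X Y :=
  (D.isCurvedAInf.multilinear X X Y Y (.nil X) (.nil Y)).mk' D.diff

theorem Deformation.diffₗ_apply (D : Deformation C B) {X Y : Ob} (a : C.HomQ B X Y) :
    D.diffₗ X Y a = D.diff a := rfl

theorem Deformation.diff_mem_grQ (D : Deformation C B) {X Y : Ob} {d : ZMod N} {a : C.HomQ B X Y}
    (ha : a ∈ C.grQ B X Y d) : D.diff a ∈ C.grQ B X Y (d + 1) := by
  have h := D.isCurvedAInf.degree X Y (.single a) [d] (.cons ha (.nil Y))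
  have e : redDeg [d] + 2 = d + 1 := by simp [redDeg]; ring
  rwa [e] at h

theorem Deformation.diff_incl_sub_mem (D : Deformation C B) {X Y : Ob} (a : C.Hom X Y) :
    D.diff (incl 𝕜 B a) - incl 𝕜 B (C.diff X Y a) ∈ infPart 𝕜 B (C.Hom X Y) 1 :=
  D.reduces X Y (.single a)

theorem Deformation.curv_mem_grQ (D : Deformation C B) (X : Ob) : D.curv X ∈ C.grQ B X X 2 := by
  have h := D.isCurvedAInf.degree X X (.nil X) [] (.nil X)
  simpa [redDeg, Deformation.curv] using h

theorem Deformation.diff_curv (D : Deformation C B) (X : Ob) : D.diff (D.curv X) = 0 := by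
  have h := D.isCurvedAInf.relation X X (.nil X) [] (.nil X)
  simpa [insertSum, Chain.splits, sgn, redDeg, Chain.length, Chain.append, Deformation.curv,
    Deformation.diff, Chain.single] using h

variable {S : HomologicalSplitting C} {X Y : Ob}

/-- The linear map that is the identity on `B ⊗̂ H` and `B ⊗̂ R` and sends `μ¹(ρ)` to `μ_q¹(ρ)` for
`ρ` in `B ⊗̂ R`. -/
noncomputable def HomologicalSplitting.Contraction.deform (c : S.Contraction X Y)
    (D : Deformation C B) : C.HomQ B X Y →ₗ[B] C.HomQ B X Y :=
  cMap B c.πH + D.diffₗ X Y ∘ₗ cMap B c.σ + cMap B c.πR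

namespace HomologicalSplitting.Contraction

variable (c : S.Contraction X Y) (D : Deformation C B)

theorem deform_apply (x : C.HomQ B X Y) :
    c.deform D x = cMap B c.πH x + D.diff (cMap B c.σ x) + cMap B c.πR x := rfl

/-- Modulo `𝔪` the deformed differential is `μ¹`, and the claim becomes `decomp`. Linearity reduces
it to constant elements. -/
theorem deform_sub_mem [IsNoetherianRing B] (x : C.HomQ B X Y) :
    c.deform D x - x ∈ infPart 𝕜 B (C.Hom X Y) 1 := by
  refine linearMap_mem_infPart_of_incl (c.deform D - LinearMap.id) (fun x => ?_) x
  have h := D.diff_incl_sub_mem (c.σ x)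
  rw [LinearMap.sub_apply, LinearMap.id_apply, deform_apply, cMap_incl, cMap_incl, cMap_incl]
  convert h using 1
  nth_rw 4 [← c.decomp x]
  rw [incl_add, incl_add]
  abel

theorem deform_of_mem_H {x : C.HomQ B X Y} (hx : x ∈ cSub 𝕜 B (S.H X Y)) :
    c.deform D x = x := by
  rw [deform_apply, cMap_eq_self_of_mem_cSub c.πH_H hx, cMap_eq_zero_of_mem_cSub c.σ_H hx,
    cMap_eq_zero_of_mem_cSub c.πR_H hx, ← D.diffₗ_apply, map_zero, add_zero, add_zero]

theorem deform_of_mem_R {x : C.HomQ B X Y} (hx : x ∈ cSub 𝕜 B (S.R X Y)) :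
    c.deform D x = x := by
  rw [deform_apply, cMap_eq_zero_of_mem_cSub c.πH_R hx, cMap_eq_zero_of_mem_cSub c.σ_R hx,
    cMap_eq_self_of_mem_cSub c.πR_R hx, ← D.diffₗ_apply, map_zero, zero_add, zero_add]

theorem σ_diff_of_mem_R {x : C.HomQ B X Y} (hx : x ∈ cSub 𝕜 B (S.R X Y)) :
    cMap B c.σ (cMap B (C.diff X Y) x) = x := by
  rw [cMap_cMap]
  exact cMap_eq_self_of_mem_cSub (fun x hx => c.σ_diff x hx) hx

theorem deform_diff_of_mem_R {x : C.HomQ B X Y} (hx : x ∈ cSub 𝕜 B (S.R X Y)) :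
    c.deform D (cMap B (C.diff X Y) x) = D.diff x := by
  have h1 : cMap B c.πH (cMap B (C.diff X Y) x) = 0 := by
    rw [cMap_cMap]
    exact cMap_eq_zero_of_mem_cSub (fun x _ => c.πH_diff x) hx
  have h2 : cMap B c.πR (cMap B (C.diff X Y) x) = 0 := by
    rw [cMap_cMap]
    exact cMap_eq_zero_of_mem_cSub (fun x _ => c.πR_diff x) hx
  rw [deform_apply, h1, h2, c.σ_diff_of_mem_R hx, zero_add, add_zero]

theorem deform_mem_grQ {d : ZMod N} {x : C.HomQ B X Y} (hx : x ∈ C.grQ B X Y d) :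
    c.deform D x ∈ C.grQ B X Y d := by
  have h := D.diff_mem_grQ (cMap_mem_cSub c.σ (c.σ_gr d) hx : _ ∈ C.grQ B X Y (d - 1))
  rw [sub_add_cancel] at h
  exact add_mem (add_mem (cMap_mem_cSub c.πH (c.πH_gr d) hx) h)
    (cMap_mem_cSub c.πR (c.πR_gr d) hx)

end HomologicalSplitting.Contraction

/-- The correction `E h` is absorbed by the `R`-component. The middle component is therefore the
same with `H_q` as with `B ⊗̂ H`, and the latter does not change along the procedure. -/
theorem exists_of_mem_Hq {D : Deformation C B} {x r : C.HomQ B X Y}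
    (h : ∃ h ∈ S.Hq D X Y, ∃ r' ∈ cSub 𝕜 B (S.R X Y), x = h + D.diff r + r') :
    ∃ h ∈ cSub 𝕜 B (S.H X Y), ∃ r' ∈ cSub 𝕜 B (S.R X Y), x = h + D.diff r + r' := by
  obtain ⟨_, ⟨h, hh, e, he, -, rfl⟩, r', hr', rfl⟩ := h
  exact ⟨h, hh, r' - e, sub_mem hr' he, by abel⟩

variable [IsNoetherianRing B] (S) (D : Deformation C B)

/-- Existence of the deformed decomposition, with control on the middle component. -/
theorem exists_deformed_decomposition (y : C.HomQ B X Y) :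
    ∃ h ∈ cSub 𝕜 B (S.H X Y), ∃ ρ ∈ cSub 𝕜 B (S.R X Y), ∃ r' ∈ cSub 𝕜 B (S.R X Y),
      y = h + D.diff ρ + r' ∧
      (∀ n, y ∈ infPart 𝕜 B (C.Hom X Y) n → ρ ∈ infPart 𝕜 B (C.Hom X Y) n) ∧
      ∀ d, y ∈ C.grQ B X Y d → ρ ∈ C.grQ B X Y (d - 1) := by
  obtain ⟨c⟩ := S.nonempty_contraction X Y
  have hT := c.deform_sub_mem D
  obtain ⟨x, -, hx⟩ := exists_perturbation_eq (c.deform D) hT (S := ⊤) (fun _ _ => trivial)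
    (fun _ _ => trivial) (y := y) trivial
  refine ⟨cMap B c.πH x, cMap_mem_cSub_range _ c.πH_mem x, cMap B c.σ x,
    cMap_mem_cSub_range _ c.σ_mem x, cMap B c.πR x, cMap_mem_cSub_range _ c.πR_mem x, hx.symm,
    fun n hn => ?_, fun d hd => ?_⟩
  · exact linearMap_mem_infPart_of_mem _ (mem_infPart_of_perturbation _ hT (hx ▸ hn))
  -- The equation is solved again inside the closed invariant part of degree `d`; injectivity
  -- identifies the two solutions.
  · obtain ⟨x', hx', h⟩ := exists_perturbation_eq (c.deform D) hT (isAdicClosed_cSub (C.gr X Y d))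
      (fun _ h => c.deform_mem_grQ D h) hd
    have e : x = x' := eq_of_forall_sub_mem_infPart fun n =>
      mem_infPart_of_perturbation _ hT (by rw [map_sub, hx, h, sub_self]; exact zero_mem _)
    exact cMap_mem_cSub c.σ (c.σ_gr d) (e ▸ hx')

/-- The middle component of the deformed decomposition of a small element is small. -/
theorem mem_infPart_of_deformed_decomposition {h ρ r' : C.HomQ B X Y}
    (hh : h ∈ cSub 𝕜 B (S.H X Y)) (hρ : ρ ∈ cSub 𝕜 B (S.R X Y)) (hr' : r' ∈ cSub 𝕜 B (S.R X Y))
    {n : ℕ} (hn : h + D.diff ρ + r' ∈ infPart 𝕜 B (C.Hom X Y) n) :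
    ρ ∈ infPart 𝕜 B (C.Hom X Y) n := by
  obtain ⟨c⟩ := S.nonempty_contraction X Y
  have h1 : c.deform D (h + cMap B (C.diff X Y) ρ + r') = h + D.diff ρ + r' := by
    rw [map_add, map_add, c.deform_of_mem_H D hh, c.deform_of_mem_R D hr',
      c.deform_diff_of_mem_R D hρ]
  have h2 := linearMap_mem_infPart_of_mem (cMap B c.σ)
    (mem_infPart_of_perturbation _ (c.deform_sub_mem D) (h1 ▸ hn))
  rwa [map_add, map_add, cMap_eq_zero_of_mem_cSub c.σ_H hh, cMap_eq_zero_of_mem_cSub c.σ_R hr',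
    c.σ_diff_of_mem_R hρ, zero_add, add_zero] at h2

theorem eq_of_deformed_decomposition {h ρ r' h₁ ρ₁ r₁' : C.HomQ B X Y}
    (hh : h ∈ cSub 𝕜 B (S.H X Y)) (hρ : ρ ∈ cSub 𝕜 B (S.R X Y)) (hr' : r' ∈ cSub 𝕜 B (S.R X Y))
    (hh₁ : h₁ ∈ cSub 𝕜 B (S.H X Y)) (hρ₁ : ρ₁ ∈ cSub 𝕜 B (S.R X Y))
    (hr₁' : r₁' ∈ cSub 𝕜 B (S.R X Y)) (heq : h + D.diff ρ + r' = h₁ + D.diff ρ₁ + r₁') :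
    ρ = ρ₁ := by
  refine eq_of_forall_sub_mem_infPart fun n => ?_
  refine mem_infPart_of_deformed_decomposition S D (sub_mem hh hh₁) (sub_mem hρ hρ₁)
    (sub_mem hr' hr₁') ?_
  have h1 : (h - h₁) + D.diff (ρ - ρ₁) + (r' - r₁') = 0 := by
    rw [← D.diffₗ_apply, map_sub, D.diffₗ_apply, D.diffₗ_apply, ← sub_eq_zero.mpr heq]
    abel
  rw [h1]
  exact zero_mem _

theorem exists_optimization_step :
    ∃ r : ∀ X : Ob, C.HomQ B X X, (∀ X, r X ∈ cSub 𝕜 B (S.R X X)) ∧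
      (∀ X : Ob, ∃ h ∈ S.Hq D X X, ∃ r' ∈ cSub 𝕜 B (S.R X X), D.curv X = h + D.diff (r X) + r') ∧
      ∃ D' : Deformation C B, IsUncurving D (-r) D' := by
  choose h hh r hr r' hr' heq hinf hgr using
    fun X => exists_deformed_decomposition S D (D.curv X)
  refine ⟨r, hr, fun X => ?_, exists_isUncurving D
    (fun X => neg_mem (hinf X 1 (D.curvature_mem X))) fun X => neg_mem ?_⟩
  -- The middle component of `μ_q¹(h)` supplies `e = E h`, which turns `h` into `h - e` in `H_q` at
  -- the expense of `r'`.
  · obtain ⟨h₁, hh₁, e, he, r₁, hr₁, heq₁, -⟩ :=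
      exists_deformed_decomposition S D (D.diff (h X))
    refine ⟨h X - e, ⟨h X, hh X, e, he, ?_, rfl⟩, r' X + e, add_mem (hr' X) he, ?_⟩
    · rw [heq₁, show h₁ + D.diff e + r₁ - D.diff e = h₁ + r₁ by abel]
      exact Submodule.add_mem_sup hh₁ hr₁
    · rw [heq X]
      abel
  · have h1 := hgr X 2 (D.curv_mem_grQ X)
    rwa [show (2 : ZMod N) - 1 = 1 by norm_num] at h1

theorem optimization_step_unique {r r₁ : ∀ X : Ob, C.HomQ B X X}
    (hr : ∀ X, r X ∈ cSub 𝕜 B (S.R X X)) (hr₁ : ∀ X, r₁ X ∈ cSub 𝕜 B (S.R X X))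
    (h : ∀ X : Ob, ∃ h ∈ S.Hq D X X, ∃ r' ∈ cSub 𝕜 B (S.R X X),
      D.curv X = h + D.diff (r X) + r')
    (h₁ : ∀ X : Ob, ∃ h ∈ S.Hq D X X, ∃ r' ∈ cSub 𝕜 B (S.R X X),
      D.curv X = h + D.diff (r₁ X) + r') : r = r₁ := by
  funext X
  obtain ⟨a, ha, r', hr', e⟩ := exists_of_mem_Hq (h X)
  obtain ⟨a₁, ha₁, r₁', hr₁', e₁⟩ := exists_of_mem_Hq (h₁ X)
  exact eq_of_deformed_decomposition S D ha (hr X) hr' ha₁ (hr₁ X) hr₁' (e.symm.trans e₁)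

theorem existsUnique_isCurvatureOptimization :
    ∃! P : (ℕ → Deformation C B) × (ℕ → ∀ X : Ob, C.HomQ B X X),
      IsCurvatureOptimization S D P.1 P.2 := by
  choose r hr hcurv next hnext using fun D : Deformation C B => exists_optimization_step S D
  refine ⟨(fun i => next^[i] D, fun i => r (next^[i] D)),
    ⟨rfl, fun i => hr _, fun i => hcurv _, fun i => ?_⟩, ?_⟩
  · simp only [Function.iterate_succ_apply']
    exact hnext _
  · rintro ⟨Cs, rs⟩ h
    have key : ∀ i, Cs i = next^[i] D := by
      intro i
      induction i with
      | zero => exact h.start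
      | succ i ih =>
        have h1 : rs i = r (next^[i] D) :=
          optimization_step_unique S (Cs i) (h.mem_R i) (hr _) (h.curv_eq i)
            (by rw [ih]; exact hcurv _)
        have h2 := h.step i
        simp only [ih, h1] at h2
        rw [Function.iterate_succ_apply']
        exact h2.unique (hnext _)
    refine Prod.ext (funext key) (funext fun i => ?_)
    exact optimization_step_unique S (Cs i) (h.mem_R i) (hr _) (h.curv_eq i)
      (by rw [key i]; exact hcurv _)

variable {S D} {Cs : ℕ → Deformation C B} {rs : ℕ → ∀ X : Ob, C.HomQ B X X}

/-- With curvature `a + μ¹(rs i) + r'` at stage `i`, the next curvature is `a + r'` modulo `𝔪` to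
the power `2 * 2 ^ i`. Subtracting `a + r'` does not touch the middle component of the next
decomposition. -/
theorem IsCurvatureOptimization.mem_infPart (h : IsCurvatureOptimization S D Cs rs) (i : ℕ) :
    ∀ X : Ob, rs i X ∈ infPart 𝕜 B (C.Hom X X) (2 ^ i) := by
  induction i with
  | zero => exact fun X => neg_mem_iff.mp ((h.step 0).mem_infPart X)
  | succ i ih =>
    intro X
    obtain ⟨a, ha, r', hr', e⟩ := exists_of_mem_Hq (h.curv_eq i X)
    obtain ⟨a₁, ha₁, r₁', hr₁', e₁⟩ := exists_of_mem_Hq (h.curv_eq (i + 1) X)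
    have h1 := (h.step i).curv_sub_curv_add_diff_mem (fun X => neg_mem (ih X)) X
    rw [Pi.neg_apply, ← (Cs i).diffₗ_apply, map_neg, (Cs i).diffₗ_apply, e, e₁] at h1
    rw [pow_succ']
    refine mem_infPart_of_deformed_decomposition S (Cs (i + 1)) (sub_mem ha₁ ha)
      (h.mem_R (i + 1) X) (sub_mem hr₁' hr') ?_
    convert h1 using 1
    abel

/-- Uncurving `Cs n` by `-rs n` and then by the negative of the next tail is uncurving by the
negative of the current tail. By uniqueness of uncurvings the result is still `D'`. -/
theorem IsCurvatureOptimization.isUncurving_tail (h : IsCurvatureOptimization S D Cs rs)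
    {r : ∀ X : Ob, C.HomQ B X X} {D' : Deformation C B} (hD' : IsUncurving D (-r) D') (n : ℕ) :
    IsUncurving (Cs n) (-(r - ∑ i ∈ Finset.range n, rs i)) D' := by
  have hgr : ∀ i X, rs i X ∈ C.grQ B X X 1 := fun i X => neg_mem_iff.mp ((h.step i).mem_gr X)
  induction n with
  | zero => simpa [h.start] using hD'
  | succ n ih =>
    obtain ⟨D'', hD''⟩ := exists_isUncurving (Cs (n + 1))
      (r := -(r - ∑ i ∈ Finset.range (n + 1), rs i))
      (fun X => neg_mem (sub_mem (neg_mem_iff.mp (hD'.mem_infPart X)) (by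
        rw [Finset.sum_apply]
        exact Submodule.sum_mem _ fun i _ =>
          infPart_antitone Nat.one_le_two_pow (h.mem_infPart i X))))
      (fun X => neg_mem (sub_mem (neg_mem_iff.mp (hD'.mem_gr X)) (by
        rw [Finset.sum_apply]
        exact Submodule.sum_mem _ fun i _ => hgr i X)))
    have h1 := (h.step n).trans hD''
    rw [show -rs n + -(r - ∑ i ∈ Finset.range (n + 1), rs i) =
      -(r - ∑ i ∈ Finset.range n, rs i) by rw [Finset.sum_range_succ]; abel] at h1
    rwa [ih.unique h1]

theorem IsCurvatureOptimization.hasOptimalCurvature (h : IsCurvatureOptimization S D Cs rs)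
    {r : ∀ X : Ob, C.HomQ B X X} (hr : ∀ X : Ob, HasAdicSum 𝕜 B (fun i => rs i X) (r X))
    {D' : Deformation C B} (hD' : IsUncurving D (-r) D') : HasOptimalCurvature S D' := by
  intro X
  obtain ⟨a, ha, ρ, hρ, r', hr', e, -⟩ := exists_deformed_decomposition S D' (D'.curv X)
  have hρ0 : ρ = 0 := by
    refine eq_zero_of_forall_mem_infPart fun n => ?_
    obtain ⟨a₁, ha₁, r₁', hr₁', e₁⟩ := exists_of_mem_Hq (h.curv_eq n X)
    have htail : ∀ X, (-(r - ∑ i ∈ Finset.range n, rs i)) X ∈ infPart 𝕜 B (C.Hom X X) n := by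
      intro X
      refine neg_mem ?_
      rw [Pi.sub_apply, Finset.sum_apply]
      refine ((hr X).sub_sum n).mem (isAdicClosed_infPart _) fun m => ?_
      exact infPart_antitone (le_trans (Nat.le_add_left n m) Nat.lt_two_pow_self.le)
        (h.mem_infPart (m + n) X)
    have h1 := (h.isUncurving_tail hD' n).curv_sub_curv_mem htail X
    have h2 : (Cs n).diff (rs n X) ∈ infPart 𝕜 B (C.Hom X X) n :=
      linearMap_mem_infPart_of_mem ((Cs n).diffₗ X X)
        (infPart_antitone Nat.lt_two_pow_self.le (h.mem_infPart n X))
    -- Modulo `𝔪ⁿ` the curvature of `D'` is that of `Cs n`, which up to the small term `μ¹(rs n)`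
    -- lies in the sum of `B ⊗̂ H` and `B ⊗̂ R`.
    refine mem_infPart_of_deformed_decomposition S D' (sub_mem ha ha₁) hρ (sub_mem hr' hr₁') ?_
    rw [e, e₁] at h1
    convert add_mem h1 h2 using 1
    abel
  have hd := D'.diff_curv X
  rw [e, hρ0, ← D'.diffₗ_apply, ← D'.diffₗ_apply, map_zero, add_zero, map_add] at hd
  -- The curved relation on the empty sequence gives `μ_q¹(a + r') = 0`, so `μ_q¹(a) = μ_q¹(-r')`
  -- and `E a = -r'`.
  refine ⟨a, ha, -r', neg_mem hr', ?_, ?_⟩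
  · rw [← D'.diffₗ_apply, ← D'.diffₗ_apply, map_neg, sub_neg_eq_add, hd]
    exact zero_mem _
  · rw [e, hρ0, ← D'.diffₗ_apply, map_zero, add_zero, sub_neg_eq_add]

end DeformedDecomposition

end CurvedAInf

/-! ### The curvature optimization lemma -/

open CurvedAInf in
theorem lemma6p21 {𝕜 : Type k} [Field 𝕜] [IsAlgClosed 𝕜] [CharZero 𝕜]
    {N : ℕ} (hN : N = 0 ∨ N = 2)
    {B : Type w} [CommRing B] [IsLocalRing B] [IsNoetherianRing B] [Algebra 𝕜 B]
    [IsAdicComplete (IsLocalRing.maximalIdeal B) B]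
    (hres : Function.Bijective (algebraMap 𝕜 (IsLocalRing.ResidueField B)))
    {Ob : Type u} (C : AInfCat.{u, v} 𝕜 N Ob) (D : Deformation C B)
    (S : HomologicalSplitting C) :
    (∃! P : (ℕ → Deformation C B) × (ℕ → ∀ X : Ob, C.HomQ B X X),
      IsCurvatureOptimization S D P.1 P.2) ∧
    ∀ (Cs : ℕ → Deformation C B) (rs : ℕ → ∀ X : Ob, C.HomQ B X X),
      IsCurvatureOptimization S D Cs rs →
      (∀ (i : ℕ) (X : Ob), rs i X ∈ infPart 𝕜 B (C.Hom X X) (2 ^ i)) ∧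
      ∃ r : ∀ X : Ob, C.HomQ B X X,
        (∀ X : Ob, HasAdicSum 𝕜 B (fun i => rs i X) (r X)) ∧
        (∀ X : Ob, r X ∈ infPart 𝕜 B (C.Hom X X) 1) ∧
        ∃ Dopt : Deformation C B,
          IsUncurving D (-r) Dopt ∧
          HasOptimalCurvature S Dopt ∧
          ∃ F : DefFunctor Dopt D id,
            F.IsGaugeEquivalence ∧
            (∀ X : Ob, F.compId (Chain.nil X) = -r X) ∧
            (∀ (X Y : Ob) (a : C.HomQ B X Y), F.compId (Chain.single a) = a) ∧
            (∀ (X Y : Ob) (p : Chain (C.HomQ B) X Y), 2 ≤ p.length → F.compId p = 0) := by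
  refine ⟨existsUnique_isCurvatureOptimization S D, fun Cs rs h => ⟨h.mem_infPart, ?_⟩⟩
  have hsum : ∀ X : Ob, ∃ x, HasAdicSum 𝕜 B (fun i => rs i X) x := fun X =>
    exists_hasAdicSum _ 0 fun i => infPart_antitone Nat.lt_two_pow_self.le (h.mem_infPart i X)
  choose r hr using hsum
  have hr1 : ∀ X, r X ∈ infPart 𝕜 B (C.Hom X X) 1 := fun X =>
    (hr X).mem (isAdicClosed_infPart 1) fun i =>
      infPart_antitone Nat.one_le_two_pow (h.mem_infPart i X)
  have hrgr : ∀ X, r X ∈ C.grQ B X X 1 := fun X =>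
    (hr X).mem (isAdicClosed_cSub _) fun i => neg_mem_iff.mp ((h.step i).mem_gr X)
  obtain ⟨Dopt, hD⟩ := exists_isUncurving D (r := -r) (fun X => neg_mem (hr1 X))
    fun X => neg_mem (hrgr X)
  exact ⟨r, hr, hr1, Dopt, hD, h.hasOptimalCurvature hr hD, hD.functor,
    hD.isGaugeEquivalence_functor, fun _ => rfl, fun _ _ _ => rfl,
    fun _ _ _ hp => uncurvingComp_of_two_le hp⟩
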